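/- Let $V$ be a vector space of finite dimension $n$ over a field $\mathbb F$ with $|\mathbb F|\ge 3$, and let $\mathsf s$ be an alternating bilinear form on $V$ of maximal rank, i.e. its radical $\mathrm{Rad}(V)$ has dimension at most $1$. For a subspace $U\le V$ put $\mathrm{Rad}(U)=U\cap U^\perp$. Let $\mathrm{Sp}(V)$ be the group of all linear automorphisms of $V$ that preserve $\mathsf s$. Let $I=\{1,\dots,n-1\}$ and let $\Gamma$ be the following geometry over $I$. The objects of type $i\in I$ are the $i$-dimensional subspaces $U$ of $V$ with $U\cap\mathrm{Rad}(V)=0$ and $\dim\mathrm{Rad}(U)\le 1$. Two objects $X,Y$ are incident if $X=Y$, or if $X\subseteq Y$ and $X\cap \mathrm{Rad}(Y)=0$, or if $Y\subseteq X$ and $Y\cap\mathrm{Rad}(X)=0$. Let $C=\{C_i\}_{i\in I}$ be a chamber of $\Gamma$, i.e. a set of pairwise incident objects, with exactly one object $C_i$ of each type $i\in I$. For $K\subseteq I$ let $P_K$ be the standard parabolic subgroup of type $K$, that is, the stabilizer in $\mathrm{Sp}(V)$ of the flag $\{C_i\mid i\in I-K\}$. Theorem. Let $J\subseteq I$ with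 $|J|\ge 3$. Then $P_J$ is the universal completion of the amalgam $\{P_{J-\{j\}}\mid j\in J\}$ of parabolic subgroups of rank $|J|-1$ contained in $P_J$. Explicitly, consider the amalgam consisting of these groups and their intersections, i.e. of all groups $P_K$ with $K\subsetneq J$, together with the inclusions $P_K\le P_L$ for $K\subsetneq L\subsetneq J$. Its universal completion $\hat G$ is the group generated by the disjoint union of the groups $P_K$, $K\subsetneq J$, subject to all relations holding within each $P_K$ and to the identification of each $x\in P_K$ with its image in $P_L$ whenever $K\subsetneq L\subsetneq J$. The canonical homomorphism $\hat G\to P_J$ induced by the inclusions $P_K\le P_J$ is an isomorphism. -/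

import Mathlib

open scoped Pointwise

namespace QuasiPhan

universe u v w

/-! ## Amalgams and their universal completions -/

/-- An amalgam of groups over a meet-semilattice `B`: a group for every element of `B`, and
connecting homomorphisms along the strict order which compose. -/
structure Amalgam (B : Type u) [SemilatticeInf B] where
  /-- The groups of the amalgam. -/
  A : B → Type v
  [grp : ∀ β, Group (A β)]
  /-- The connecting homomorphisms. -/
  φ : ∀ {β γ : B}, β < γ → A β →* A γ
  φ_comp : ∀ {β γ δ : B} (h₁ : β < γ) (h₂ : γ < δ) (x : A β),
    φ h₂ (φ h₁ x) = φ (h₁.trans h₂) x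

attribute [instance] Amalgam.grp

namespace Amalgam

variable {B : Type u} [SemilatticeInf B]

/-- The defining relators of the universal completion, as words in the disjoint union of the
groups: the multiplication tables of the groups, and the identification of each element with its
images under the connecting homomorphisms. -/
inductive Rel (𝒜 : Amalgam.{u, v} B) : FreeGroup (Σ β, 𝒜.A β) → Prop
  | mul (β : B) (x y : 𝒜.A β) :
      Rel 𝒜 (FreeGroup.of ⟨β, x⟩ * FreeGroup.of ⟨β, y⟩ * (FreeGroup.of ⟨β, x * y⟩)⁻¹)
  | ident {β γ : B} (h : β < γ) (x : 𝒜.A β) :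
      Rel 𝒜 (FreeGroup.of ⟨β, x⟩ * (FreeGroup.of ⟨γ, 𝒜.φ h x⟩)⁻¹)

/-- The universal completion (amalgamated sum) of an amalgam, by generators and relations. -/
abbrev UniversalCompletion (𝒜 : Amalgam.{u, v} B) : Type (max u v) :=
  PresentedGroup {r | Rel 𝒜 r}

/-- A compatible family of homomorphisms from the groups of the amalgam into `G`. -/
def Compatible (𝒜 : Amalgam.{u, v} B) {G : Type w} [Group G] (f : ∀ β, 𝒜.A β →* G) : Prop :=
  ∀ {β γ : B} (h : β < γ) (x : 𝒜.A β), f γ (𝒜.φ h x) = f β x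

/-- The canonical homomorphism from the universal completion which a compatible family of
homomorphisms induces. -/
def desc (𝒜 : Amalgam.{u, v} B) {G : Type w} [Group G] (f : ∀ β, 𝒜.A β →* G)
    (hf : 𝒜.Compatible f) : 𝒜.UniversalCompletion →* G :=
  PresentedGroup.toGroup (f := fun p : Σ β, 𝒜.A β => f p.1 p.2) (by
    intro r hr
    cases hr with
    | mul β x y => simp
    | ident h x => simp [hf h x])

/-- `G`, with the homomorphisms `f`, is the universal completion of the amalgam: the family is
compatible and the induced homomorphism from the universal completion to `G` is an isomorphism. -/
def IsUniversalCompletion (𝒜 : Amalgam.{u, v} B) {G : Type w} [Group G]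
    (f : ∀ β, 𝒜.A β →* G) : Prop :=
  ∃ hf : 𝒜.Compatible f, Function.Bijective (𝒜.desc f hf)

end Amalgam

/-! ## Pre-geometries -/

/-- A pre-geometry over the type set `I`. -/
structure PreGeometry (I : Type u) where
  /-- The objects. -/
  Obj : Type v
  /-- The type function. -/
  typ : Obj → I
  /-- The incidence relation. -/
  Inc : Obj → Obj → Prop
  inc_refl : ∀ X, Inc X X
  inc_symm : ∀ X Y, Inc X Y → Inc Y X
  eq_or_typ_ne : ∀ X Y, Inc X Y → X = Y ∨ typ X ≠ typ Y

namespace PreGeometry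

variable {I : Type u}

/-- A flag is a set of pairwise incident objects. -/
def IsFlag (Γ : PreGeometry.{u, v} I) (E : Set Γ.Obj) : Prop :=
  ∀ X ∈ E, ∀ Y ∈ E, Γ.Inc X Y

/-- A chamber is a flag whose type is the whole type set. -/
def IsChamber (Γ : PreGeometry.{u, v} I) (C : Set Γ.Obj) : Prop :=
  Γ.IsFlag C ∧ Γ.typ '' C = Set.univ

/-- For a chamber `C`, the subflag of cotype `J`, that is, of type `I - J`. -/
def subflag (Γ : PreGeometry.{u, v} I) (C : Set Γ.Obj) (J : Set I) : Set Γ.Obj :=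
  {X | X ∈ C ∧ Γ.typ X ∉ J}

/-- The standard parabolic subgroup of type `J` with respect to the chamber `C`: the stabilizer
of the residue of type `J` on `C`, that is, of the subflag of `C` of cotype `J`. -/
def parabolic (Γ : PreGeometry.{u, v} I) (G : Type w) [Group G] [MulAction G Γ.Obj]
    (C : Set Γ.Obj) (J : Set I) : Subgroup G :=
  MulAction.stabilizer G (Γ.subflag C J)

/-- For a type-preserving action, `P_K` is contained in `P_J` when `K ⊆ J`. -/
theorem parabolic_mono (Γ : PreGeometry.{u, v} I) {G : Type w} [Group G] [MulAction G Γ.Obj]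
    (hG : ∀ (g : G) (X : Γ.Obj), Γ.typ (g • X) = Γ.typ X) {C : Set Γ.Obj}
    {K J : Set I} (h : K ≤ J) :
    Γ.parabolic G C K ≤ Γ.parabolic G C J := by
  have key : ∀ g ∈ Γ.parabolic G C K, g • Γ.subflag C J ⊆ Γ.subflag C J := by
    rintro g hg _ ⟨X, ⟨hX, hXJ⟩, rfl⟩
    have h1 : g • X ∈ Γ.subflag C K := by
      have h2 : g • Γ.subflag C K = Γ.subflag C K := hg
      rw [← h2]
      exact Set.smul_mem_smul_set ⟨hX, fun hK => hXJ (h hK)⟩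
    refine ⟨h1.1, ?_⟩
    change Γ.typ (g • X) ∉ J
    rwa [hG]
  intro g hg
  refine Set.Subset.antisymm (key g hg) ?_
  have := key g⁻¹ (inv_mem hg)
  exact Set.subset_smul_set_iff.2 this

/-- The amalgam of all parabolic subgroups `P_K` with `K` a proper subset of `J`. It consists of
the subgroups `P_{J - {j}}`, `j ∈ J`, and their intersections; the connecting homomorphisms are
the inclusions. -/
def parabolicAmalgam (Γ : PreGeometry.{u, v} I) (G : Type w) [Group G] [MulAction G Γ.Obj]
    (hG : ∀ (g : G) (X : Γ.Obj), Γ.typ (g • X) = Γ.typ X) (C : Set Γ.Obj)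
    (J : Set I) : Amalgam (Set.Iio J) where
  A K := Γ.parabolic G C K.1
  φ h := Subgroup.inclusion (Γ.parabolic_mono hG (le_of_lt h))
  φ_comp _ _ _ := rfl

end PreGeometry

/-! ## The quasi-Phan geometry of a symplectic space -/

section Symplectic

variable {F : Type u} {V : Type v} [Field F] [AddCommGroup V] [Module F V]

/-- The radical `U ∩ U^⊥` of a subspace. -/
def rad (s : LinearMap.BilinForm F V) (U : Submodule F V) : Submodule F V :=
  U ⊓ s.orthogonal U

/-- The symplectic group: all linear automorphisms of `V` which preserve the form. -/
def Sp (s : LinearMap.BilinForm F V) : Subgroup (V ≃ₗ[F] V) where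
  carrier := {g | ∀ x y, s (g x) (g y) = s x y}
  mul_mem' := by
    intro a b ha hb x y
    simp only [LinearEquiv.mul_apply]
    rw [ha, hb]
  one_mem' := fun _ _ => rfl
  inv_mem' := by
    intro a ha x y
    have h := ha (a⁻¹ x) (a⁻¹ y)
    have e : ∀ z, a (a⁻¹ z) = z := fun z => a.apply_symm_apply z
    rw [e, e] at h
    exact h.symm

theorem map_rad (s : LinearMap.BilinForm F V) (g : Sp s) (U : Submodule F V) :
    rad s (U.map (g : V ≃ₗ[F] V).toLinearMap) = (rad s U).map (g : V ≃ₗ[F] V).toLinearMap := by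
  ext x
  simp only [rad, Submodule.mem_inf, Submodule.mem_map, LinearMap.BilinForm.mem_orthogonal_iff,
    LinearEquiv.coe_coe]
  constructor
  · rintro ⟨⟨y, hy, rfl⟩, h⟩
    refine ⟨y, ⟨hy, fun z hz => ?_⟩, rfl⟩
    rw [← g.2 z y]
    exact h _ ⟨z, hz, rfl⟩
  · rintro ⟨y, ⟨hy, h⟩, rfl⟩
    refine ⟨⟨y, hy, rfl⟩, ?_⟩
    rintro _ ⟨z, hz, rfl⟩
    rw [g.2 z y]
    exact h z hz

variable (F V) in
/-- The type set `{1, …, n - 1}`, where `n = dim V`. -/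
abbrev TypeSet : Type := Set.Ico 1 (Module.finrank F V)

/-- The objects of the quasi-Phan geometry: the proper non-zero subspaces of `V` which meet the
radical of `V` trivially and whose radical has dimension at most one. -/
@[ext]
structure Object (s : LinearMap.BilinForm F V) where
  /-- The underlying subspace. -/
  carrier : Submodule F V
  finrank_mem : Module.finrank F carrier ∈ Set.Ico 1 (Module.finrank F V)
  disjoint_rad : Disjoint carrier (rad s ⊤)
  finrank_rad_le : Module.finrank F (rad s carrier) ≤ 1

/-- The quasi-Phan geometry. Objects have their dimension as type; two distinct objects are
incident when one of them is contained in the other and meets the radical of the other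
trivially. -/
noncomputable def geometry [FiniteDimensional F V] (s : LinearMap.BilinForm F V) :
    PreGeometry (TypeSet F V) where
  Obj := Object s
  typ X := ⟨Module.finrank F X.carrier, X.finrank_mem⟩
  Inc X Y := X = Y ∨
    (X.carrier ≤ Y.carrier ∧ Disjoint X.carrier (rad s Y.carrier)) ∨
    (Y.carrier ≤ X.carrier ∧ Disjoint Y.carrier (rad s X.carrier))
  inc_refl _ := Or.inl rfl
  inc_symm X Y := by
    rintro (h | h | h)
    · exact Or.inl h.symm
    · exact Or.inr (Or.inr h)
    · exact Or.inr (Or.inl h)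
  eq_or_typ_ne X Y := by
    intro h
    by_cases ht : Module.finrank F X.carrier = Module.finrank F Y.carrier
    · left
      rcases h with h | ⟨h, _⟩ | ⟨h, _⟩
      · exact h
      · exact Object.ext (Submodule.eq_of_le_of_finrank_eq h ht)
      · exact Object.ext (Submodule.eq_of_le_of_finrank_eq h ht.symm).symm
    · right
      exact fun h' => ht (congrArg Subtype.val h')

/-- The action of the symplectic group on the objects, by taking images of subspaces. -/
noncomputable instance (s : LinearMap.BilinForm F V) : MulAction (Sp s) (Object s) where
  smul g X :=
    { carrier := X.carrier.map (g : V ≃ₗ[F] V).toLinearMap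
      finrank_mem := by
        rw [LinearEquiv.finrank_map_eq (g : V ≃ₗ[F] V) X.carrier]
        exact X.finrank_mem
      disjoint_rad := by
        have h : rad s ⊤ = (rad s ⊤).map (g : V ≃ₗ[F] V).toLinearMap := by
          rw [← map_rad, Submodule.map_top, LinearEquiv.range]
        rw [h]
        exact (Submodule.disjoint_map (g : V ≃ₗ[F] V).injective X.disjoint_rad)
      finrank_rad_le := by
        rw [map_rad, LinearEquiv.finrank_map_eq (g : V ≃ₗ[F] V) (rad s X.carrier)]
        exact X.finrank_rad_le }
  one_smul X := Object.ext (Submodule.map_id X.carrier)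
  mul_smul g h X := Object.ext
    (Submodule.map_comp (h : V ≃ₗ[F] V).toLinearMap (g : V ≃ₗ[F] V).toLinearMap X.carrier)

noncomputable instance [FiniteDimensional F V] (s : LinearMap.BilinForm F V) :
    MulAction (Sp s) (geometry s).Obj :=
  inferInstanceAs (MulAction (Sp s) (Object s))

theorem typ_smul [FiniteDimensional F V] (s : LinearMap.BilinForm F V) (g : Sp s)
    (X : (geometry s).Obj) : (geometry s).typ (g • X) = (geometry s).typ X :=
  Subtype.ext (LinearEquiv.finrank_map_eq (g : V ≃ₗ[F] V) (Object.carrier X))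

end Symplectic

end QuasiPhan

/-! The engine is Tits' lemma: a group acting transitively on small flags of each type in a
connected, simply connected geometry is the amalgam of the stabilizers of the objects of a chamber.
It is applied to `P_J` acting on the residue of type `J`. Simple connectedness is phrased
cohomologically: every cocycle on incident pairs, with values in any group, is a coboundary. Taking
the universal completion itself as coefficient group, `exists_hom_of_cocyclesTrivial` produces the
inverse of the canonical homomorphism.

Transitivity is a Witt-type statement. Every flag extends to a full chain of subspaces from 0 to `V`
(`IsRadChain.exists_fullChain`), and an isometry between two full chains is built one dimension at a
time (`IsFullChain.exists_isometry`).

Simple connectedness splits into two cases. If `J` has a gap, the residue is the join of two smaller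
residues. A join of nonempty posets is simply connected as soon as one of them is connected, and
`|J| ≥ 3` makes one part large enough. If `J` has no gap, the residue is an open interval between
chain members `A` and `B` with `dim B ≥ dim A + 4`. A cocycle on it is determined by its values on a
graph of points, the points being objects of dimension `dim A + 1`. This graph has diameter at most
two, its closed walks decompose into triangles, and each triangle lies below an object, possibly
after coning it off with a fourth point.

If `A` is nondegenerate, points come from vectors of `B ∩ A^⊥` outside `Rad(B)`, and adjacent means
not perpendicular. If `A` has radical spanned by `r`, fix `x₀` in `B` with `s r x₀ ≠ 0`. The points
are then `A + ⟨x₀ + d⟩` with `d` in `B ∩ A^⊥`, and two are adjacent when their difference lies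
outside the radical of `B ∩ A^⊥`. The bound `|F| ≥ 3` supplies scalars that avoid two given values.
-/

namespace QuasiPhan

/-! ### Connectedness and simple connectedness of posets through cocycles. -/

section Cocycles

variable {α : Type*}

/-- Any two elements of `S` are joined by a path of comparable elements of `S`. -/
def IsConn (S : Set α) (le : α → α → Prop) : Prop :=
  ∀ P : α → Prop, (∀ x ∈ S, ∀ y ∈ S, le x y → (P x ↔ P y)) → ∀ x ∈ S, ∀ y ∈ S, P x → P y

/-- Every cocycle on the comparable pairs of `S` with values in `H` is a coboundary. -/
def CocyclesTrivial (H : Type*) [Group H] (S : Set α) (le : α → α → Prop) : Prop :=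
  ∀ c : α → α → H,
    (∀ x ∈ S, ∀ y ∈ S, ∀ z ∈ S, le x y → le y z → c x y * c y z = c x z) →
    ∃ p : α → H, ∀ x ∈ S, ∀ y ∈ S, le x y → c x y = (p x)⁻¹ * p y

theorem IsConn.eq {S : Set α} {le : α → α → Prop} (h : IsConn S le) {T : Type*} (f : α → T)
    (hf : ∀ x ∈ S, ∀ y ∈ S, le x y → f x = f y) {x y : α} (hx : x ∈ S) (hy : y ∈ S) :
    f x = f y :=
  h (fun z => f x = f z) (fun a ha b hb hab => by rw [hf a ha b hb hab]) x hx y hy rfl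

theorem IsConn.union {S₁ S₂ : Set α} {le : α → α → Prop} (h : ∀ x ∈ S₁, ∀ y ∈ S₂, le x y)
    (h₁ : S₁.Nonempty) (h₂ : S₂.Nonempty) : IsConn (S₁ ∪ S₂) le := by
  obtain ⟨a, ha⟩ := h₁
  obtain ⟨b, hb⟩ := h₂
  intro P hP
  have key : ∀ x ∈ S₁, ∀ y ∈ S₂, (P x ↔ P y) := fun x hx y hy =>
    hP x (Or.inl hx) y (Or.inr hy) (h x hx y hy)
  have all : ∀ x ∈ S₁ ∪ S₂, (P x ↔ P b) := by
    rintro x (hx | hx)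
    · exact key x hx b hb
    · exact (key a ha x hx).symm.trans (key a ha b hb)
  intro x hx y hy hPx
  exact (all y hy).2 ((all x hx).1 hPx)

/-- This is the join of two spaces: simply connected once both parts are nonempty and one is
connected. The conditions `hn` and `hd` keep the order between the parts one-directional. -/
theorem CocyclesTrivial.union {H : Type*} [Group H] {S₁ S₂ : Set α} {le : α → α → Prop}
    (h : ∀ x ∈ S₁, ∀ y ∈ S₂, le x y) (hn : ∀ x ∈ S₁, ∀ y ∈ S₂, ¬ le y x)
    (hd : ∀ x ∈ S₁, x ∉ S₂) (h₁ : S₁.Nonempty) (h₂ : S₂.Nonempty)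
    (hc : IsConn S₁ le ∨ IsConn S₂ le) : CocyclesTrivial H (S₁ ∪ S₂) le := by
  classical
  obtain ⟨a, ha⟩ := h₁
  obtain ⟨b, hb⟩ := h₂
  intro c hcoc
  -- Going from `x` to `y` directly or through `b` and `a` gives the same value, because the
  -- quadrangle can be filled by moving one vertex through whichever part is connected.
  have key : ∀ x ∈ S₁, ∀ y ∈ S₂, c x y = c x b * (c a b)⁻¹ * c a y := by
    intro x hx y hy
    rcases hc with hc | hc
    · have := hc.eq (fun z => (c z b)⁻¹ * c z y) (by
        intro u hu v hv huv
        rw [← hcoc u (Or.inl hu) v (Or.inl hv) b (Or.inr hb) huv (h v hv b hb),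
          ← hcoc u (Or.inl hu) v (Or.inl hv) y (Or.inr hy) huv (h v hv y hy)]
        group) hx ha
      rw [mul_assoc, ← this]
      group
    · have := hc.eq (fun z => c x z * (c a z)⁻¹) (by
        intro u hu v hv huv
        rw [← hcoc x (Or.inl hx) u (Or.inr hu) v (Or.inr hv) (h x hx u hu) huv,
          ← hcoc a (Or.inl ha) u (Or.inr hu) v (Or.inr hv) (h a ha u hu) huv]
        group) hb hy
      rw [this]
      group
  -- The potential is the value of `c` along a path from `b`: directly to points of `S₁`, through
  -- `a` to points of `S₂`.
  refine ⟨fun x => if x ∈ S₁ then (c x b)⁻¹ else (c a b)⁻¹ * c a x, ?_⟩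
  rintro x (hx | hx) y (hy | hy) hxy
  · simp only [hx, hy, if_true]
    rw [← hcoc x (Or.inl hx) y (Or.inl hy) b (Or.inr hb) hxy (h y hy b hb)]
    group
  · have hy' : y ∉ S₁ := fun hy' => hd y hy' hy
    simp only [hx, hy', if_true, if_false]
    rw [key x hx y hy]
    group
  · exact absurd hxy (hn y hy x hx)
  · have hx' : x ∉ S₁ := fun hx' => hd x hx' hx
    have hy' : y ∉ S₁ := fun hy' => hd y hy' hy
    simp only [hx', hy', if_false]
    rw [← hcoc a (Or.inl ha) x (Or.inr hx) y (Or.inr hy) (h a ha x hx) hxy]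
    group

/-- A graph of points of the poset `S`; adjacent points have a distinguished upper bound. -/
structure PointGraph (S : Set α) (le : α → α → Prop) (ι : Type*) where
  /-- The points, as elements of the poset. -/
  pt : ι → α
  /-- The upper bound of two adjacent points. -/
  join : ι → ι → α
  /-- Adjacency of points. -/
  adj : ι → ι → Prop
  pt_mem : ∀ i, pt i ∈ S
  join_mem : ∀ {i j}, adj i j → join i j ∈ S
  pt_le : ∀ {i j}, adj i j → le (pt i) (join i j)
  adj_symm : ∀ {i j}, adj i j → adj j i
  join_comm : ∀ i j, join i j = join j i
  exists_pt_le : ∀ U ∈ S, ∃ i, le (pt i) U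
  exists_adj : ∀ i j, ∃ z, adj i z ∧ adj j z

namespace PointGraph

variable {S : Set α} {le : α → α → Prop} {ι : Type*} (Γ : PointGraph S le ι)

theorem pt_le' {i j : ι} (h : Γ.adj i j) : le (Γ.pt j) (Γ.join i j) := by
  rw [Γ.join_comm]
  exact Γ.pt_le (Γ.adj_symm h)

theorem isConn (Γ : PointGraph S le ι) : IsConn S le := by
  intro P hP
  have hadj : ∀ {i j}, Γ.adj i j → (P (Γ.pt i) ↔ P (Γ.pt j)) := fun {i j} h =>
    (hP _ (Γ.pt_mem i) _ (Γ.join_mem h) (Γ.pt_le h)).trans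
      (hP _ (Γ.pt_mem j) _ (Γ.join_mem h) (Γ.pt_le' h)).symm
  intro x hx y hy hPx
  obtain ⟨i, hi⟩ := Γ.exists_pt_le x hx
  obtain ⟨j, hj⟩ := Γ.exists_pt_le y hy
  obtain ⟨z, hz, hz'⟩ := Γ.exists_adj i j
  rw [← hP _ (Γ.pt_mem j) y hy hj, hadj hz', ← hadj hz, hP _ (Γ.pt_mem i) x hx hi]
  exact hPx

/-- Three points whose pairwise joins have a common upper bound. -/
def Bounded (i j k : ι) : Prop :=
  ∃ U ∈ S, le (Γ.join i j) U ∧ le (Γ.join j k) U ∧ le (Γ.join i k) U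

/-- Elementary moves between points below `U`. -/
def Link (U : α) (i j : ι) : Prop :=
  (Γ.adj i j ∧ le (Γ.join i j) U) ∨
    (Γ.pt i = Γ.pt j ∧ le (Γ.pt i) U ∧ ∃ z, Γ.adj i z ∧ Γ.adj j z ∧ Γ.join i z = Γ.join j z)

/-- The potential at `i` is the value of `e` along a two-step path from `o`. By `h4` a quadrangle
through `o` and `i` splits into triangles, so the middle vertex does not matter. By `h3` both ends
of an edge can be reached through the same middle vertex. -/
theorem exists_potential {H : Type*} [Group H] (o : ι)
    (h3 : ∀ i j, Γ.adj i j → ∃ z, Γ.adj o z ∧ Γ.adj i z ∧ Γ.adj j z)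
    (h4 : ∀ i z z', Γ.adj o z → Γ.adj i z → Γ.adj o z' → Γ.adj i z' →
      Γ.adj o i ∨ Γ.adj z z' ∨ ∃ w, Γ.adj o w ∧ Γ.adj i w ∧ Γ.adj z w ∧ Γ.adj z' w)
    (e : ι → ι → H)
    (htri : ∀ i j k, Γ.adj i j → Γ.adj j k → Γ.adj i k → e i j * e j k = e i k) :
    ∃ p : ι → H, ∀ i j, Γ.adj i j → e i j = (p i)⁻¹ * p j := by
  choose z hoz hiz using fun i => Γ.exists_adj o i
  have key : ∀ i z z', Γ.adj o z → Γ.adj i z → Γ.adj o z' → Γ.adj i z' →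
      e o z * e z i = e o z' * e z' i := by
    have direct : ∀ i z z', Γ.adj o z → Γ.adj i z → Γ.adj o z' → Γ.adj i z' → Γ.adj z z' →
        e o z * e z i = e o z' * e z' i := by
      intro i z z' h1 h2 h3 h4 h5
      rw [← htri o z z' h1 h5 h3, ← htri z z' i h5 (Γ.adj_symm h4) (Γ.adj_symm h2), mul_assoc]
    intro i z z' h1 h2 h3 h4'
    rcases h4 i z z' h1 h2 h3 h4' with h | h | ⟨w, h5, h6, h7, h8⟩
    · rw [htri o z i h1 (Γ.adj_symm h2) h, htri o z' i h3 (Γ.adj_symm h4') h]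
    · exact direct i z z' h1 h2 h3 h4' h
    · rw [direct i z w h1 h2 h5 h6 h7, direct i z' w h3 h4' h5 h6 h8]
  refine ⟨fun i => e o (z i) * e (z i) i, fun i j hij => ?_⟩
  obtain ⟨w, h5, h6, h7⟩ := h3 i j hij
  dsimp only
  rw [key i (z i) w (hoz i) (hiz i) h5 h6, key j (z j) w (hoz j) (hiz j) h5 h7,
    ← htri w i j (Γ.adj_symm h6) hij (Γ.adj_symm h7)]
  group

/-- The cocycle is pushed to the edges of the point graph, integrated there, and the potential is
carried up to each `U` from any point below it. Independence of that point is what `hlink` provides.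
-/
theorem cocyclesTrivial {H : Type*} [Group H] [Nonempty ι]
    (htrans : ∀ x ∈ S, ∀ y ∈ S, ∀ z ∈ S, le x y → le y z → le x z)
    (h3 : ∀ o i j, Γ.adj i j → ∃ z, Γ.adj o z ∧ Γ.adj i z ∧ Γ.adj j z)
    (h4 : ∀ o i z z', Γ.adj o z → Γ.adj i z → Γ.adj o z' → Γ.adj i z' →
      Γ.adj o i ∨ Γ.adj z z' ∨ ∃ w, Γ.adj o w ∧ Γ.adj i w ∧ Γ.adj z w ∧ Γ.adj z' w)
    (htri : ∀ i j k, Γ.adj i j → Γ.adj j k → Γ.adj i k → Γ.Bounded i j k ∨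
      ∃ w, Γ.adj i w ∧ Γ.adj j w ∧ Γ.adj k w ∧
        Γ.Bounded i j w ∧ Γ.Bounded j k w ∧ Γ.Bounded i k w)
    (hlink : ∀ U ∈ S, ∀ i j, le (Γ.pt i) U → le (Γ.pt j) U →
      Relation.EqvGen (Γ.Link U) i j) :
    CocyclesTrivial H S le := by
  intro c hc
  -- The value of `c` along the path up from `pt i` to the join and down to `pt j`.
  let e : ι → ι → H := fun i j => c (Γ.pt i) (Γ.join i j) * (c (Γ.pt j) (Γ.join i j))⁻¹
  have he : ∀ i j, ∀ U ∈ S, Γ.adj i j → le (Γ.join i j) U →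
      e i j = c (Γ.pt i) U * (c (Γ.pt j) U)⁻¹ := by
    intro i j U hU hij hL
    rw [← hc _ (Γ.pt_mem i) _ (Γ.join_mem hij) U hU (Γ.pt_le hij) hL,
      ← hc _ (Γ.pt_mem j) _ (Γ.join_mem hij) U hU (Γ.pt_le' hij) hL]
    simp only [e]
    group
  have hbdd : ∀ i j k, Γ.adj i j → Γ.adj j k → Γ.adj i k → Γ.Bounded i j k →
      e i j * e j k = e i k := by
    rintro i j k hij hjk hik ⟨U, hU, h1, h2, h3⟩
    rw [he i j U hU hij h1, he j k U hU hjk h2, he i k U hU hik h3]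
    group
  have htriangle : ∀ i j k, Γ.adj i j → Γ.adj j k → Γ.adj i k → e i j * e j k = e i k := by
    intro i j k hij hjk hik
    rcases htri i j k hij hjk hik with h | ⟨w, hi, hj, hk, h1, h2, h3⟩
    · exact hbdd i j k hij hjk hik h
    · have e1 := hbdd i j w hij hj hi h1
      have e2 := hbdd j k w hjk hk hj h2
      have e3 := hbdd i k w hik hk hi h3
      rw [← e2, ← mul_assoc] at e1
      rw [← e3] at e1
      exact mul_right_cancel e1
  obtain ⟨o⟩ := ‹Nonempty ι›
  obtain ⟨p, hp⟩ := Γ.exists_potential o (h3 o) (h4 o) e htriangle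
  have hK : ∀ U ∈ S, ∀ i j, le (Γ.pt i) U → le (Γ.pt j) U →
      p i * c (Γ.pt i) U = p j * c (Γ.pt j) U := by
    intro U hU i j hi hj
    have := hlink U hU i j hi hj
    clear hi hj
    induction this with
    | rel i j h =>
      -- The second kind of link treats two indices of the same point: equal edges to a common
      -- neighbour force equal potentials.
      rcases h with ⟨hij, hL⟩ | ⟨hij, -, z, hiz, hjz, hL⟩
      · have := he i j U hU hij hL
        rw [hp i j hij] at this
        have h2 : p j * c (Γ.pt j) U = p i * ((p i)⁻¹ * p j) * c (Γ.pt j) U := by group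
        rw [h2, this]
        group
      · have h1 : e i z = e j z := by simp only [e, hij, hL]
        rw [hp i z hiz, hp j z hjz] at h1
        rw [hij, inv_injective (mul_right_cancel h1)]
    | refl => rfl
    | symm _ _ _ ih => exact ih.symm
    | trans _ _ _ _ _ ih1 ih2 => exact ih1.trans ih2
  choose! q hq using Γ.exists_pt_le
  refine ⟨fun U => p (q U) * c (Γ.pt (q U)) U, fun U hU W hW hUW => ?_⟩
  have hqW : le (Γ.pt (q U)) W := htrans _ (Γ.pt_mem _) U hU W hW (hq U hU) hUW
  dsimp only
  rw [hK W hW (q W) (q U) (hq W hW) hqW, ← hc _ (Γ.pt_mem _) U hU W hW (hq U hU) hUW]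
  group

end PointGraph

end Cocycles

/-! ### Tits' lemma. -/

section TitsLemma

variable {P X H : Type*} [Group P] [MulAction P X] [Group H]

/-- Tits' lemma: a group acting flag-transitively on a simply connected geometry is the
amalgam of the stabilizers of the elements of a chamber. Here `τ x` is the element of the base
chamber with the type of `x`, and `F b` is a homomorphism on the stabilizer of `b = τ x`. -/
theorem exists_hom_of_cocyclesTrivial (S : Set X) (inc : X → X → Prop) (τ : X → X)
    (F : X → P → H)
    (hS : ∀ (g : P), ∀ x ∈ S, g • x ∈ S)
    (hτS : ∀ x ∈ S, τ x ∈ S) (hτ : ∀ (g : P) (x : X), τ (g • x) = τ x)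
    (hττ : ∀ x, τ (τ x) = τ x)
    (hinc : ∀ (g : P) (x y : X), inc x y → inc (g • x) (g • y))
    (hrefl : ∀ x, inc x x)
    (hbase : ∀ x ∈ S, ∀ y ∈ S, inc (τ x) (τ y))
    (htrans : ∀ x ∈ S, ∀ y ∈ S, ∀ z ∈ S, inc x y → inc y z → inc x z →
      ∃ g : P, g • τ x = x ∧ g • τ y = y ∧ g • τ z = z)
    (hF : ∀ x ∈ S, ∀ g h : P, g • τ x = τ x → h • τ x = τ x →
      F (τ x) (g * h) = F (τ x) g * F (τ x) h)
    (hFF : ∀ x ∈ S, ∀ y ∈ S, ∀ g : P, g • τ x = τ x → g • τ y = τ y → F (τ x) g = F (τ y) g)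
    (hconn : IsConn S inc)
    (hcoc : ∀ c : X → X → H,
      (∀ x ∈ S, ∀ y ∈ S, ∀ z ∈ S, inc x y → inc y z → inc x z → c x y * c y z = c x z) →
      ∃ p : X → H, ∀ x ∈ S, ∀ y ∈ S, inc x y → c x y = (p x)⁻¹ * p y)
    (hne : S.Nonempty) :
    ∃ Φ : P →* H, (∀ x ∈ S, ∀ g : P, g • τ x = τ x → Φ g = F (τ x) g) ∧
      ∀ π : H →* P, (∀ x ∈ S, ∀ g : P, g • τ x = τ x → π (F (τ x) g) = g) →
        ∀ g, π (Φ g) = g := by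
  classical
  have hF1 : ∀ x ∈ S, F (τ x) 1 = 1 := by
    intro x hx
    have := hF x hx 1 1 (one_smul _ _) (one_smul _ _)
    rw [mul_one] at this
    exact left_eq_mul.1 this
  have hinv : ∀ x ∈ S, ∀ g : P, g • τ x = τ x → F (τ x) g⁻¹ = (F (τ x) g)⁻¹ := by
    intro x hx g hg
    rw [eq_inv_iff_mul_eq_one, ← hF x hx g⁻¹ g (by rw [inv_smul_eq_iff, hg]) hg, inv_mul_cancel,
      hF1 x hx]
  -- A transporter `γ x` from the base element to `x`, normalized to be trivial on the base chamber.
  have hex : ∀ x, ∃ g : P, (x ∈ S → g • τ x = x) ∧ (τ x = x → g = 1) := by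
    intro x
    by_cases hx : τ x = x
    · exact ⟨1, fun _ => by rw [one_smul, hx], fun _ => rfl⟩
    · by_cases hxS : x ∈ S
      · obtain ⟨g, hg, -⟩ := htrans x hxS x hxS x hxS (hrefl x) (hrefl x) (hrefl x)
        exact ⟨g, fun _ => hg, fun h => absurd h hx⟩
      · exact ⟨1, fun h => absurd h hxS, fun h => absurd h hx⟩
  choose γ hγ hγ1 using hex
  have hex2 : ∀ x y, ∃ g : P, x ∈ S → y ∈ S → inc x y → g • τ x = x ∧ g • τ y = y := by
    intro x y
    by_cases h : x ∈ S ∧ y ∈ S ∧ inc x y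
    · obtain ⟨g, h1, h2, -⟩ := htrans x h.1 y h.2.1 y h.2.1 h.2.2 (hrefl y) h.2.2
      exact ⟨g, fun _ _ _ => ⟨h1, h2⟩⟩
    · exact ⟨1, fun h1 h2 h3 => absurd ⟨h1, h2, h3⟩ h⟩
  choose δ hδ using hex2
  have stab : ∀ x (g h : P), g • τ x = x → h • τ x = x → (g⁻¹ * h) • τ x = τ x := by
    intro x g h hg hh
    rw [mul_smul, hh, inv_smul_eq_iff, hg]
  -- If `δ` carries both base elements to `x` and `y`, then `γ x⁻¹ γ y` factors through `δ` into two
  -- stabilizer elements. The product of their images under `F` does not depend on `δ`, because `F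
  -- (τ x)` and `F (τ y)` agree on the common stabilizer.
  let c : X → X → H := fun x y =>
    F (τ x) ((γ x)⁻¹ * δ x y) * F (τ y) ((δ x y)⁻¹ * γ y)
  have hc : ∀ x ∈ S, ∀ y ∈ S, inc x y → ∀ g : P, g • τ x = x → g • τ y = y →
      c x y = F (τ x) ((γ x)⁻¹ * g) * F (τ y) (g⁻¹ * γ y) := by
    intro x hx y hy hxy g hgx hgy
    obtain ⟨hdx, hdy⟩ := hδ x y hx hy hxy
    have e1 : (γ x)⁻¹ * δ x y = (γ x)⁻¹ * g * (g⁻¹ * δ x y) := by group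
    have e2 : g⁻¹ * γ y = g⁻¹ * δ x y * ((δ x y)⁻¹ * γ y) := by group
    have e3 := hFF x hx y hy (g⁻¹ * δ x y) (stab x _ _ hgx hdx) (stab y _ _ hgy hdy)
    simp only [c]
    rw [e1, hF x hx _ _ (stab x _ _ (hγ x hx) hgx) (stab x _ _ hgx hdx), e2,
      hF y hy _ _ (stab y _ _ hgy hdy) (stab y _ _ hdy (hγ y hy)), e3, mul_assoc]
  obtain ⟨p, hp⟩ := hcoc c (by
    intro x hx y hy z hz hxy hyz hxz
    obtain ⟨g, h1, h2, h3⟩ := htrans x hx y hy z hz hxy hyz hxz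
    rw [hc x hx y hy hxy g h1 h2, hc y hy z hz hyz g h2 h3, hc x hx z hz hxz g h1 h3]
    have e : F (τ y) (g⁻¹ * γ y) * F (τ y) ((γ y)⁻¹ * g) = 1 := by
      rw [← hF y hy _ _ (stab y _ _ h2 (hγ y hy)) (stab y _ _ (hγ y hy) h2)]
      rw [show g⁻¹ * γ y * ((γ y)⁻¹ * g) = 1 by group, hF1 y hy]
    rw [mul_assoc, ← mul_assoc (F (τ y) _) (F (τ y) _), e, one_mul])
  -- Translation by `h` replaces the transporter of `x` by another one. The difference fixes `τ x`,
  -- so the translated cocycle is `c` twisted by `a h`.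
  let a : P → X → H := fun h x => F (τ x) ((γ x)⁻¹ * h⁻¹ * γ (h • x))
  have sa : ∀ (h : P), ∀ x ∈ S, ((γ x)⁻¹ * h⁻¹ * γ (h • x)) • τ x = τ x := by
    intro h x hx
    have := hγ (h • x) (hS h x hx)
    rw [hτ] at this
    rw [mul_smul, this, mul_smul, inv_smul_smul, inv_smul_eq_iff, hγ x hx]
  have hca : ∀ (h : P), ∀ x ∈ S, ∀ y ∈ S, inc x y →
      c (h • x) (h • y) = (a h x)⁻¹ * c x y * a h y := by
    intro h x hx y hy hxy
    obtain ⟨hdx, hdy⟩ := hδ x y hx hy hxy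
    rw [hc (h • x) (hS h x hx) (h • y) (hS h y hy) (hinc h x y hxy) (h * δ x y)
      (by rw [hτ, mul_smul, hdx]) (by rw [hτ, mul_smul, hdy]), hτ, hτ]
    have e1 : (γ (h • x))⁻¹ * (h * δ x y) =
        ((γ x)⁻¹ * h⁻¹ * γ (h • x))⁻¹ * ((γ x)⁻¹ * δ x y) := by group
    have e2 : (h * δ x y)⁻¹ * γ (h • y) =
        (δ x y)⁻¹ * γ y * ((γ y)⁻¹ * h⁻¹ * γ (h • y)) := by group
    rw [e1, e2, hF x hx _ _ (by rw [inv_smul_eq_iff, sa h x hx]) (stab x _ _ (hγ x hx) hdx),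
      hF y hy _ _ (stab y _ _ hdy (hγ y hy)) (sa h y hy), hinv x hx _ (sa h x hx)]
    simp only [a, c, mul_assoc]
  -- Both `p` and its translate by `h`, corrected by `a h`, are potentials of `c`. They therefore
  -- differ by a constant on the connected set `S`, and this constant is multiplicative in `h`.
  let Ψ : P → X → H := fun h x => p (h • x) * (a h x)⁻¹ * (p x)⁻¹
  have hΨ : ∀ h, ∀ x ∈ S, ∀ y ∈ S, Ψ h x = Ψ h y := by
    intro h x hx y hy
    refine hconn.eq (Ψ h) ?_ hx hy
    intro x hx y hy hxy
    have e1 := hp _ (hS h x hx) _ (hS h y hy) (hinc h x y hxy)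
    rw [hca h x hx y hy hxy] at e1
    have e2 : p y = p x * c x y := by rw [hp x hx y hy hxy]; group
    have e3 : p (h • y) = p (h • x) * ((a h x)⁻¹ * c x y * a h y) := by rw [e1]; group
    simp only [Ψ]
    rw [e2, e3]
    group
  have hΨmul : ∀ g h, ∀ x ∈ S, Ψ (g * h) x = Ψ g (h • x) * Ψ h x := by
    intro g h x hx
    have e : a (g * h) x = a h x * a g (h • x) := by
      simp only [a]
      have s2 := sa g (h • x) (hS h x hx)
      rw [hτ] at s2
      rw [hτ, ← hF x hx _ _ (sa h x hx) s2, mul_smul]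
      congr 1
      group
    simp only [Ψ]
    rw [e, mul_smul]
    group
  obtain ⟨o, ho⟩ := hne
  have hγτ : ∀ x, γ (τ x) = 1 := fun x => hγ1 _ (hττ x)
  have hpτ : ∀ x ∈ S, p (τ x) = p (τ o) := by
    intro x hx
    have e1 := hp _ (hτS o ho) _ (hτS x hx) (hbase o ho x hx)
    rw [hc _ (hτS o ho) _ (hτS x hx) (hbase o ho x hx) 1 (by rw [one_smul, hττ])
      (by rw [one_smul, hττ]), hγτ, hγτ, inv_one, one_mul, hττ, hττ, hF1 o ho, hF1 x hx,
      one_mul] at e1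
    exact (inv_mul_eq_one.1 e1.symm).symm
  have hΨτ : ∀ x ∈ S, ∀ g : P, g • τ x = τ x →
      Ψ g (τ x) = p (τ o) * F (τ x) g * (p (τ o))⁻¹ := by
    intro x hx g hg
    simp only [Ψ, a, hg]
    rw [hγτ, hττ, inv_one, one_mul, mul_one, hinv x hx g hg, inv_inv, hpτ x hx]
  have hb := hτS o ho
  -- All base elements have the same potential `p (τ o)`; conjugating by it makes the restriction to
  -- each stabilizer equal to `F`.
  refine ⟨MonoidHom.mk' (fun g => (p (τ o))⁻¹ * Ψ g (τ o) * p (τ o)) ?_, ?_, ?_⟩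
  · intro g h
    rw [hΨmul g h _ hb, hΨ g (h • τ o) (hS h _ hb) (τ o) hb]
    group
  · intro x hx g hg
    simp only [MonoidHom.mk'_apply]
    rw [hΨ g (τ o) hb (τ x) (hτS x hx), hΨτ x hx g hg]
    group
  · intro π hπ g
    -- Under `π` the cocycle becomes the coboundary of `γ`, so `π ∘ p` agrees with `γ` on `S` up to
    -- a constant left factor.
    have hπc : ∀ x ∈ S, ∀ y ∈ S, inc x y → π (c x y) = (γ x)⁻¹ * γ y := by
      intro x hx y hy hxy
      obtain ⟨hdx, hdy⟩ := hδ x y hx hy hxy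
      simp only [c]
      rw [map_mul, hπ x hx _ (stab x _ _ (hγ x hx) hdx), hπ y hy _ (stab y _ _ hdy (hγ y hy))]
      group
    have hκ : ∀ x ∈ S, π (p x) * (γ x)⁻¹ = π (p (τ o)) := by
      intro x hx
      have := hconn.eq (fun x => π (p x) * (γ x)⁻¹) (by
        intro x hx y hy hxy
        have e1 := hπc x hx y hy hxy
        rw [hp x hx y hy hxy, map_mul, map_inv] at e1
        have e2 : π (p y) = π (p x) * ((γ x)⁻¹ * γ y) := by rw [← e1]; group
        rw [e2]
        group) hx hb
      rw [this, hγτ, inv_one, mul_one]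
    have e1 := hκ _ (hS g _ hb)
    have e2 : π (p (g • τ o)) = π (p (τ o)) * γ (g • τ o) := by rw [← e1]; group
    have e3 : π (a g (τ o)) = g⁻¹ * γ (g • τ o) := by
      have := sa g _ hb
      rw [hττ] at this
      simp only [a]
      rw [hττ, hπ o ho _ this, hγτ]
      group
    simp only [MonoidHom.mk'_apply, Ψ]
    rw [map_mul, map_mul, map_mul, map_mul, map_inv, map_inv, e2, e3]
    group

end TitsLemma
-- Alternating forms, radicals and Witt-type extension along chains.
section LinearAlgebra

open Submodule Module

/-- The form in which `|F| ≥ 3` is used throughout. -/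
theorem exists_ne_and_ne {F : Type*} (hF : 3 ≤ ENat.card F) (a b : F) : ∃ t : F, t ≠ a ∧ t ≠ b := by
  by_contra! h
  have h1 : (Set.univ : Set F) ⊆ {a, b} := fun t _ => by
    by_cases ht : t = a
    · exact Or.inl ht
    · exact Or.inr (h t ht)
  have h2 := Set.encard_le_encard h1
  rw [Set.encard_univ] at h2
  have h3 := (hF.trans h2).trans (Set.encard_insert_le {b} a)
  rw [Set.encard_singleton] at h3
  exact absurd h3 (by decide)

variable {F V : Type*} [Field F] [AddCommGroup V] [Module F V]

theorem exists_apply_ne_zero₂ {U : Submodule F V} {f g : V →ₗ[F] F} (hf : ∃ u ∈ U, f u ≠ 0)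
    (hg : ∃ u ∈ U, g u ≠ 0) : ∃ u ∈ U, f u ≠ 0 ∧ g u ≠ 0 := by
  obtain ⟨u, hu, hfu⟩ := hf
  obtain ⟨v, hv, hgv⟩ := hg
  by_cases hgu : g u = 0
  · by_cases hfv : f v = 0
    · exact ⟨u + v, add_mem hu hv, by simpa [hfv] using hfu, by simpa [hgu] using hgv⟩
    · exact ⟨v, hv, hfv, hgv⟩
  · exact ⟨u, hu, hfu, hgu⟩

/-- A vector space over a field with more than two elements is not the union of three proper
subspaces. -/
theorem exists_apply_ne_zero₃ (hF : ∀ a b : F, ∃ t, t ≠ a ∧ t ≠ b) {U : Submodule F V}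
    {f g h : V →ₗ[F] F} (hf : ∃ u ∈ U, f u ≠ 0) (hg : ∃ u ∈ U, g u ≠ 0)
    (hh : ∃ u ∈ U, h u ≠ 0) : ∃ u ∈ U, f u ≠ 0 ∧ g u ≠ 0 ∧ h u ≠ 0 := by
  have main : ∀ (f g : V →ₗ[F] F) (v u : V), v ∈ U → u ∈ U → f v ≠ 0 → g v ≠ 0 → h v = 0 →
      h u ≠ 0 → f u = 0 → ∃ u ∈ U, f u ≠ 0 ∧ g u ≠ 0 ∧ h u ≠ 0 := by
    intro f g v u hv hu hfv hgv hhv hhu hfu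
    -- On the line `v + t u` the value of `f` is constant, `h` vanishes only at `t = 0`, and `g` at
    -- no more than one `t`. If `g u = 0` the second excluded value is irrelevant, since `g v ≠ 0`.
    obtain ⟨t, ht0, ht⟩ := hF 0 (-(g v) / g u)
    refine ⟨v + t • u, add_mem hv (smul_mem _ _ hu), by simpa [hfu] using hfv, ?_, ?_⟩
    · intro h0
      simp only [map_add, map_smul, smul_eq_mul] at h0
      by_cases hgu : g u = 0
      · rw [hgu, mul_zero, add_zero] at h0
        exact hgv h0
      · exact ht (by rw [eq_div_iff hgu]; linear_combination h0)
    · simpa [hhv] using ⟨ht0, hhu⟩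
  obtain ⟨v, hv, hfv, hgv⟩ := exists_apply_ne_zero₂ hf hg
  obtain ⟨u, hu, hhu⟩ := hh
  by_cases hhv : h v = 0
  · by_cases hfu : f u = 0
    · exact main f g v u hv hu hfv hgv hhv hhu hfu
    · by_cases hgu : g u = 0
      · obtain ⟨w, hw, h1, h2, h3⟩ := main g f v u hv hu hgv hfv hhv hhu hgu
        exact ⟨w, hw, h2, h1, h3⟩
      · exact ⟨u, hu, hfu, hgu, hhu⟩
  · exact ⟨v, hv, hfv, hgv, hhv⟩

theorem mem_sup_singleton {A : Submodule F V} {x v : V} :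
    v ∈ A ⊔ F ∙ x ↔ ∃ a ∈ A, ∃ t : F, a + t • x = v := by
  simp only [mem_sup, mem_span_singleton]
  constructor
  · rintro ⟨a, ha, _, ⟨t, rfl⟩, h⟩
    exact ⟨a, ha, t, h⟩
  · rintro ⟨a, ha, t, h⟩
    exact ⟨a, ha, _, ⟨t, rfl⟩, h⟩

theorem self_mem_sup_singleton (A : Submodule F V) (x : V) : x ∈ A ⊔ F ∙ x :=
  mem_sup_right (mem_span_singleton_self x)

theorem sup_singleton_le {A B : Submodule F V} {x : V} (hA : A ≤ B) (hx : x ∈ B) :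
    A ⊔ F ∙ x ≤ B :=
  sup_le hA ((span_singleton_le_iff_mem _ _).2 hx)

/-- `X` is contained in `Y` and meets the radical of `Y` trivially. -/
def RadFree (s : LinearMap.BilinForm F V) (X Y : Submodule F V) : Prop :=
  X ≤ Y ∧ Disjoint X (rad s Y)

variable {s : LinearMap.BilinForm F V}

theorem rad_le (U : Submodule F V) : rad s U ≤ U := inf_le_left

theorem RadFree.eq_zero {X Y : Submodule F V} (h : RadFree s X Y) {x : V} (hx : x ∈ X)
    (hY : ∀ y ∈ Y, s y x = 0) : x = 0 :=
  disjoint_def.1 h.2 x hx ⟨h.1 hx, hY⟩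

theorem radFree_iff {X Y : Submodule F V} :
    RadFree s X Y ↔ X ≤ Y ∧ ∀ x ∈ X, (∀ y ∈ Y, s y x = 0) → x = 0 :=
  ⟨fun h => ⟨h.1, fun _ hx hY => h.eq_zero hx hY⟩,
    fun h => ⟨h.1, disjoint_def.2 fun x hx hr => h.2 x hx hr.2⟩⟩

theorem RadFree.mono {X Y Z : Submodule F V} (h : X ≤ Y) (h2 : RadFree s Y Z) :
    RadFree s X Z :=
  ⟨h.trans h2.1, h2.2.mono_left h⟩

theorem RadFree.trans {X Y Z : Submodule F V} (h : RadFree s X Y) (h2 : RadFree s Y Z) :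
    RadFree s X Z := h2.mono h.1

theorem RadFree.of_le {X Y Z : Submodule F V} (h : RadFree s X Y) (h2 : Y ≤ Z) :
    RadFree s X Z :=
  radFree_iff.2 ⟨h.1.trans h2, fun _ hx hZ => h.eq_zero hx fun y hy => hZ y (h2 hy)⟩

theorem rad_eq_bot_iff {X : Submodule F V} : rad s X = ⊥ ↔ RadFree s X X := by
  constructor
  · intro h
    exact ⟨le_rfl, by rw [h]; exact disjoint_bot_right⟩
  · intro h
    exact (h.2.eq_bot_of_ge (rad_le X))

theorem RadFree.of_rad_eq_bot {X Y : Submodule F V} (h : rad s X = ⊥) (h2 : X ≤ Y) :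
    RadFree s X Y := (rad_eq_bot_iff.1 h).of_le h2

theorem IsAlt_swap (hs : s.IsAlt) {x y : V} (h : s x y = 0) : s y x = 0 := by
  rw [← hs.neg_eq, h, neg_zero]

theorem RadFree.exists_apply_ne_zero (hs : s.IsAlt) {X Y : Submodule F V} (h : RadFree s X Y)
    {r : V} (hr : r ∈ X) (hr0 : r ≠ 0) : ∃ y ∈ Y, s r y ≠ 0 := by
  by_contra! h2
  exact hr0 (h.eq_zero hr fun y hy => IsAlt_swap hs (h2 y hy))

/-- For a nondegenerate `A`, extending by a vector of `B ∩ A^⊥` outside the radical of `B`. -/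
theorem radFree_sup_singleton {A B : Submodule F V} (hb : rad s A = ⊥)
    (hAB : A ≤ B) {x : V} (hx : x ∈ B) (hxA : ∀ a ∈ A, s a x = 0) (hxB : x ∉ rad s B) :
    RadFree s (A ⊔ F ∙ x) B := by
  refine radFree_iff.2 ⟨sup_singleton_le hAB hx, fun v hv hv' => ?_⟩
  obtain ⟨a, ha, t, rfl⟩ := mem_sup_singleton.1 hv
  have ha0 : a = 0 := (rad_eq_bot_iff.1 hb).eq_zero ha fun y hy => by
    have := hv' y (hAB hy)
    rwa [map_add, map_smul, hxA y hy, smul_zero, add_zero] at this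
  subst ha0
  rw [zero_add] at hv' ⊢
  by_contra h0
  have ht : t ≠ 0 := fun ht => h0 (by rw [ht, zero_smul])
  refine hxB ⟨hx, fun y hy => ?_⟩
  have := hv' y hy
  rw [map_smul, smul_eq_mul] at this
  exact (mul_eq_zero.1 this).resolve_left ht

variable [FiniteDimensional F V]

theorem finrank_sup_singleton_le (A : Submodule F V) (x : V) :
    finrank F ↥(A ⊔ F ∙ x) ≤ finrank F A + 1 :=
  (finrank_add_le_finrank_add_finrank _ _).trans
    (Nat.add_le_add_left ((finrank_span_le_card ({x} : Set V)).trans (by simp)) _)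

theorem sup_singleton_eq {X Y : Submodule F V} {z : V} (h : X ≤ Y) (hz : z ∈ Y) (hzX : z ∉ X)
    (hd : finrank F Y ≤ finrank F X + 1) : X ⊔ F ∙ z = Y := by
  refine eq_of_le_of_finrank_le (sup_singleton_le h hz) (hd.trans ?_)
  refine finrank_lt_finrank_of_lt (lt_of_le_of_ne le_sup_left fun he => hzX ?_)
  rw [he]
  exact self_mem_sup_singleton X z

theorem exists_mem_notMem {X Y : Submodule F V} (hd : finrank F X < finrank F Y) :
    ∃ y ∈ Y, y ∉ X := by
  by_contra! h
  exact absurd (finrank_mono (show Y ≤ X from h)) (by omega)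

theorem exists_apply_eq {U : Submodule F V} (h : rad s U = ⊥) (φ : V →ₗ[F] F) :
    ∃ w ∈ U, ∀ x ∈ U, s x w = φ x := by
  let T : U →ₗ[F] Module.Dual F U := LinearMap.domRestrict₁₂ (LinearMap.flip s) U U
  have hT : Function.Injective T := by
    rw [← LinearMap.ker_eq_bot, LinearMap.ker_eq_bot']
    intro w hw
    refine Subtype.ext ((rad_eq_bot_iff.1 h).eq_zero w.2 fun y hy => ?_)
    exact LinearMap.congr_fun hw ⟨y, hy⟩
  have hT' : Function.Surjective T :=
    (LinearMap.injective_iff_surjective_of_finrank_eq_finrank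
      (Subspace.dual_finrank_eq (K := F) (V := U)).symm).1 hT
  obtain ⟨w, hw⟩ := hT' (φ.domRestrict U)
  exact ⟨w, w.2, fun x hx => LinearMap.congr_fun hw ⟨x, hx⟩⟩

theorem exists_sub_orthogonal {U : Submodule F V} (h : rad s U = ⊥) (v : V) :
    ∃ w ∈ U, ∀ x ∈ U, s x (v - w) = 0 := by
  obtain ⟨w, hw, h2⟩ := exists_apply_eq h ((LinearMap.flip s) v)
  refine ⟨w, hw, fun x hx => ?_⟩
  rw [map_sub, h2 x hx, LinearMap.flip_apply, sub_self]

/-- The radical of the larger space meets the nondegenerate `A` trivially, and `A` has codimension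
at most one. -/
theorem finrank_rad_sup_singleton_le {A : Submodule F V} (h : rad s A = ⊥) (x : V) :
    finrank F (rad s (A ⊔ F ∙ x)) ≤ 1 := by
  have h1 := finrank_sup_add_finrank_inf_eq (rad s (A ⊔ F ∙ x)) A
  have h2 : rad s (A ⊔ F ∙ x) ⊓ A = ⊥ :=
    ((RadFree.of_rad_eq_bot h le_sup_left).2.symm).eq_bot
  have h3 : finrank F ↥(rad s (A ⊔ F ∙ x) ⊔ A) ≤ finrank F ↥(A ⊔ F ∙ x) :=
    finrank_mono (sup_le (rad_le _) le_sup_left)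
  have h4 := finrank_sup_singleton_le A x
  rw [h2, finrank_bot] at h1
  omega

theorem exists_smul_eq_of_finrank_le_one {R : Submodule F V} (h : finrank F R ≤ 1) {r v : V}
    (hr : r ∈ R) (hr0 : r ≠ 0) (hv : v ∈ R) : ∃ t : F, t • r = v := by
  have h1 : F ∙ r = R := by
    refine eq_of_le_of_finrank_le ((span_singleton_le_iff_mem _ _).2 hr) ?_
    rwa [finrank_span_singleton hr0]
  rw [← h1] at hv
  exact mem_span_singleton.1 hv

/-- Let `a + t x` be in the radical. Pairing with `r` gives `t = 0`; then `a` is a multiple of `r`,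
and pairing with `x` kills it. -/
theorem rad_sup_singleton_eq_bot {A : Submodule F V} (hs : s.IsAlt)
    (hA : finrank F (rad s A) ≤ 1) {r x : V} (hr : r ∈ rad s A) (hx : s r x ≠ 0) :
    rad s (A ⊔ F ∙ x) = ⊥ := by
  have hr0 : r ≠ 0 := by
    rintro rfl
    simp at hx
  refine rad_eq_bot_iff.2 (radFree_iff.2 ⟨le_rfl, fun v hv hv' => ?_⟩)
  obtain ⟨a, ha, t, rfl⟩ := mem_sup_singleton.1 hv
  have h1 := hv' r (mem_sup_left hr.1)
  rw [map_add, map_smul, IsAlt_swap hs (hr.2 a ha), zero_add, smul_eq_mul] at h1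
  have ht : t = 0 := (mul_eq_zero.1 h1).resolve_right hx
  subst ht
  rw [zero_smul, add_zero] at hv' ⊢
  obtain ⟨c, rfl⟩ := exists_smul_eq_of_finrank_le_one hA hr hr0
    ⟨ha, fun y hy => hv' y (mem_sup_left hy)⟩
  have h2 := IsAlt_swap hs (hv' x (self_mem_sup_singleton A x))
  rw [map_smul, LinearMap.smul_apply, smul_eq_mul] at h2
  rw [(mul_eq_zero.1 h2).resolve_right hx, zero_smul]

/-- The extension step for isometries. If `X` is nondegenerate, represent `φ` inside `X` and add a
vector of `Y` perpendicular to `X` and outside it. Otherwise enlarge `X` to a nondegenerate space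
and represent `φ` there; the solution avoids `X` because `φ` is nonzero on the radical of `X`. -/
theorem RadFree.exists_notMem_apply_eq (hs : s.IsAlt) {X Y : Submodule F V} (h : RadFree s X Y)
    (hlt : finrank F X < finrank F Y) (hX : finrank F (rad s X) ≤ 1) (φ : V →ₗ[F] F)
    (hφ : ∀ r ∈ rad s X, φ r = 0 → r = 0) :
    ∃ z ∈ Y, z ∉ X ∧ ∀ x ∈ X, s x z = φ x := by
  by_cases hb : rad s X = ⊥
  · obtain ⟨y, hy, hyX⟩ := exists_mem_notMem hlt
    obtain ⟨w, hw, hw'⟩ := exists_sub_orthogonal hb y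
    obtain ⟨u, hu, hu'⟩ := exists_apply_eq hb φ
    refine ⟨u + (y - w), add_mem (h.1 hu) (sub_mem hy (h.1 hw)), fun hmem => hyX ?_, ?_⟩
    · have := add_mem (sub_mem hmem hu) hw
      rwa [add_sub_cancel_left, sub_add_cancel] at this
    · intro x hx
      rw [map_add, hu' x hx, hw' x hx, add_zero]
  · obtain ⟨r, hr, hr0⟩ := exists_mem_ne_zero_of_ne_bot hb
    obtain ⟨y, hy, hry⟩ := h.exists_apply_ne_zero hs hr.1 hr0
    obtain ⟨z, hz, hz'⟩ := exists_apply_eq (rad_sup_singleton_eq_bot hs hX hr hry) φ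
    refine ⟨z, sup_singleton_le h.1 hy hz, fun hzX => hr0 (hφ r hr ?_),
      fun x hx => hz' x (mem_sup_left hx)⟩
    rw [← hz' r (mem_sup_left hr.1)]
    exact IsAlt_swap hs (hr.2 z hzX)

/-- If `Y` is large and `X` is nondegenerate, then some vector of `Y` is perpendicular to `X` and
not in the radical of `Y`. -/
theorem exists_orthogonal_notMem_rad {X Y : Submodule F V} (hXY : X ≤ Y) (hb : rad s X = ⊥)
    (hY : finrank F (rad s Y) ≤ 1) (hd : finrank F X + 2 ≤ finrank F Y) :
    ∃ z ∈ Y, (∀ x ∈ X, s x z = 0) ∧ z ∉ rad s Y := by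
  by_contra! h
  have h1 : Y ≤ X ⊔ rad s Y := by
    intro y hy
    obtain ⟨w, hw, hw'⟩ := exists_sub_orthogonal hb y
    have := add_mem (mem_sup_left (T := rad s Y) hw)
      (mem_sup_right (S := X) (h (y - w) (sub_mem hy (hXY hw)) hw'))
    rwa [add_sub_cancel] at this
  have h2 := finrank_mono h1
  have h3 := finrank_add_le_finrank_add_finrank X (rad s Y)
  omega

/-- Adjoin to a nondegenerate `X` a vector of `Y ∩ X^⊥` outside `Rad(Y)`, which exists because the
gap is at least two. Adjoin to a degenerate `X` a vector that makes it nondegenerate. -/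
theorem RadFree.exists_between (hs : s.IsAlt) {X Y : Submodule F V} (h : RadFree s X Y)
    (hX : finrank F (rad s X) ≤ 1) (hY : finrank F (rad s Y) ≤ 1)
    (hd : finrank F X + 2 ≤ finrank F Y) :
    ∃ Z, RadFree s X Z ∧ RadFree s Z Y ∧ finrank F (rad s Z) ≤ 1 ∧
      finrank F Z = finrank F X + 1 := by
  have hdim : ∀ z : V, z ∉ X → finrank F ↥(X ⊔ F ∙ z) = finrank F X + 1 := by
    intro z hz
    refine le_antisymm (finrank_sup_singleton_le X z) ?_
    refine finrank_lt_finrank_of_lt (lt_of_le_of_ne le_sup_left fun he => hz ?_)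
    rw [he]
    exact self_mem_sup_singleton X z
  by_cases hb : rad s X = ⊥
  · obtain ⟨z, hzY, hzX, hz⟩ := exists_orthogonal_notMem_rad h.1 hb hY hd
    refine ⟨X ⊔ F ∙ z, RadFree.of_rad_eq_bot hb le_sup_left,
      radFree_sup_singleton hb h.1 hzY hzX hz, finrank_rad_sup_singleton_le hb z,
      hdim z fun hmem => hz ?_⟩
    rw [(rad_eq_bot_iff.1 hb).eq_zero hmem hzX]
    exact zero_mem _
  · obtain ⟨r, hr, hr0⟩ := exists_mem_ne_zero_of_ne_bot hb
    obtain ⟨y, hy, hry⟩ := h.exists_apply_ne_zero hs hr.1 hr0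
    have hZ := rad_sup_singleton_eq_bot hs hX hr hry
    have hZ' : finrank F (rad s (X ⊔ F ∙ y)) ≤ 1 := by
      rw [hZ, finrank_bot]
      exact zero_le_one
    refine ⟨X ⊔ F ∙ y, (rad_eq_bot_iff.1 hZ).mono le_sup_left,
      RadFree.of_rad_eq_bot hZ (sup_singleton_le h.1 hy), hZ',
      hdim y fun hyX => hry (IsAlt_swap hs (hr.2 y hyX))⟩

/-- A full chain of subspaces of maximal rank, consecutive ones being incident. -/
structure IsFullChain (s : LinearMap.BilinForm F V) (C : ℕ → Submodule F V) : Prop where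
  finrank_eq : ∀ i ≤ finrank F V, finrank F (C i) = i
  finrank_rad_le : ∀ i ≤ finrank F V, finrank F (rad s (C i)) ≤ 1
  radFree : ∀ i j, i < j → j ≤ finrank F V → RadFree s (C i) (C j)

theorem IsFullChain.zero {C : ℕ → Submodule F V} (hC : IsFullChain s C) : C 0 = ⊥ :=
  finrank_eq_zero.1 (hC.finrank_eq 0 (Nat.zero_le _))

theorem IsFullChain.top {C : ℕ → Submodule F V} (hC : IsFullChain s C) :
    C (finrank F V) = ⊤ :=
  eq_top_of_finrank_eq (hC.finrank_eq _ le_rfl)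

/-- Induction along the chains: the image of one new basis vector must have prescribed pairings with
the space already mapped. As the form is alternating, there is no condition on its pairing with
itself. -/
theorem IsFullChain.exists_isometry (hs : s.IsAlt) {C C' : ℕ → Submodule F V}
    (hC : IsFullChain s C) (hC' : IsFullChain s C') :
    ∃ g ∈ Sp s, ∀ i ≤ finrank F V, (C i).map (g : V ≃ₗ[F] V).toLinearMap = C' i := by
  have main : ∀ k ≤ finrank F V, ∃ g : V →ₗ[F] V, (∀ i ≤ k, (C i).map g = C' i) ∧
      ∀ x ∈ C k, ∀ y ∈ C k, s (g x) (g y) = s x y := by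
    intro k
    induction k with
    | zero =>
      intro _
      refine ⟨0, fun i hi => ?_, fun x hx y hy => ?_⟩
      · rw [Nat.le_zero.1 hi, hC.zero, hC'.zero, Submodule.map_bot]
      · rw [hC.zero, mem_bot] at hx
        simp [hx]
    | succ k ih =>
      intro hk
      obtain ⟨g, hgC, hgs⟩ := ih (by omega)
      have hinj : LinearMap.ker (g.domRestrict (C k)) = ⊥ := by
        have h1 := LinearMap.finrank_range_add_finrank_ker (g.domRestrict (C k))
        rw [LinearMap.range_domRestrict, hgC k le_rfl, hC.finrank_eq k (by omega),
          hC'.finrank_eq k (by omega)] at h1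
        exact finrank_eq_zero.1 (by omega)
      obtain ⟨l, hl⟩ := LinearMap.exists_leftInverse_of_injective _ hinj
      have hlg : ∀ x (hx : x ∈ C k), l (g x) = ⟨x, hx⟩ := fun x hx =>
        LinearMap.congr_fun hl ⟨x, hx⟩
      obtain ⟨z, hz, hzC⟩ := exists_mem_notMem (X := C k) (Y := C (k + 1))
        (by rw [hC.finrank_eq k (by omega), hC.finrank_eq (k + 1) hk]; omega)
      have hCz : C k ⊔ F ∙ z = C (k + 1) := sup_singleton_eq
        (hC.radFree k (k + 1) (by omega) hk).1 hz hzC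
        (by rw [hC.finrank_eq k (by omega), hC.finrank_eq (k + 1) hk])
      have hmemC' : ∀ x ∈ C k, g x ∈ C' k := fun x hx => by
        rw [← hgC k le_rfl]
        exact mem_map_of_mem hx
      -- The functional is `s (g⁻¹ ·) z`, written with a left inverse of `g` on `C k`. It is nonzero
      -- on nonzero radical vectors because `C k` misses the radical of `C (k + 1)`.
      obtain ⟨z', hz', hz'C, hz's⟩ := (hC'.radFree k (k + 1) (by omega) hk).exists_notMem_apply_eq
        hs (by rw [hC'.finrank_eq k (by omega), hC'.finrank_eq (k + 1) hk]; omega)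
        (hC'.finrank_rad_le k (by omega)) (((LinearMap.flip s) z).comp ((C k).subtype.comp l)) (by
          rintro r' ⟨hr', hr'r⟩ h0
          obtain ⟨r, hr, rfl⟩ : r' ∈ (C k).map g := by rwa [hgC k le_rfl]
          simp only [LinearMap.comp_apply, subtype_apply, hlg r hr, LinearMap.flip_apply] at h0
          have : r = 0 := (hC.radFree k (k + 1) (by omega) hk).eq_zero hr fun y hy => by
            rw [← hCz] at hy
            obtain ⟨x, hx, t, rfl⟩ := mem_sup_singleton.1 hy
            have h2 : s (g x) (g r) = 0 := hr'r (g x) (hmemC' x hx)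
            rw [hgs x hx r hr] at h2
            rw [map_add, LinearMap.add_apply, h2, map_smul, LinearMap.smul_apply,
              IsAlt_swap hs h0, smul_zero, add_zero]
          rw [this, map_zero])
      have hC'z : C' k ⊔ F ∙ z' = C' (k + 1) := sup_singleton_eq
        (hC'.radFree k (k + 1) (by omega) hk).1 hz' hz'C
        (by rw [hC'.finrank_eq k (by omega), hC'.finrank_eq (k + 1) hk])
      obtain ⟨f, hfz, hf⟩ := exists_le_ker_of_notMem hzC
      -- `f` vanishes on `C k` and not at `z`, so this rank-one correction changes only where `z`
      -- goes.
      let g' : V →ₗ[F] V := g + (f.smulRight ((f z)⁻¹ • (z' - g z)))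
      have hg' : ∀ x ∈ C k, g' x = g x := fun x hx => by
        have : f x = 0 := hf hx
        simp [g', this]
      have hg'z : g' z = z' := by
        simp [g', smul_smul, hfz]
      have hmap : ∀ i ≤ k, (C i).map g' = (C i).map g := by
        intro i hi
        have hle : C i ≤ C k := by
          rcases hi.lt_or_eq with h | h
          · exact (hC.radFree i k h (by omega)).1
          · rw [h]
        ext v
        constructor
        · rintro ⟨x, hx, rfl⟩
          exact ⟨x, hx, (hg' x (hle hx)).symm⟩
        · rintro ⟨x, hx, rfl⟩
          exact ⟨x, hx, hg' x (hle hx)⟩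
      have hzs : ∀ x ∈ C k, s (g x) z' = s x z := fun x hx => by
        rw [hz's _ (hmemC' x hx)]
        simp [hlg x hx]
      refine ⟨g', fun i hi => ?_, ?_⟩
      · rcases hi.lt_or_eq with h | h
        · rw [hmap i (by omega), hgC i (by omega)]
        · rw [h, ← hCz, Submodule.map_sup, hmap k le_rfl, hgC k le_rfl, ← hC'z, map_span,
            Set.image_singleton, hg'z]
      · rw [← hCz]
        intro x hx y hy
        obtain ⟨a, ha, t, rfl⟩ := mem_sup_singleton.1 hx
        obtain ⟨b, hb, u, rfl⟩ := mem_sup_singleton.1 hy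
        have e1 : s z' (g b) = s z b := by rw [← hs.neg_eq, ← hs.neg_eq b z, hzs b hb]
        simp only [map_add, map_smul, LinearMap.add_apply, LinearMap.smul_apply, hg' a ha,
          hg' b hb, hg'z, hgs a ha b hb, hzs a ha, e1, hs.self_eq_zero]
  obtain ⟨g, hgC, hgs⟩ := main _ le_rfl
  have hsurj : Function.Surjective g := by
    rw [← LinearMap.range_eq_top, LinearMap.range_eq_map, ← hC.top, hgC _ le_rfl, hC'.top, hC.top]
  have hbij : Function.Bijective g := ⟨LinearMap.injective_iff_surjective.2 hsurj, hsurj⟩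
  refine ⟨LinearEquiv.ofBijective g hbij, ?_, fun i hi => ?_⟩
  · intro x y
    have htop : ∀ v : V, v ∈ C (finrank F V) := fun v => by rw [hC.top]; trivial
    exact hgs x (htop x) y (htop y)
  · rw [← hgC i hi]
    rfl

/-- A set of subspaces of maximal rank which form a chain for incidence. -/
structure IsRadChain (s : LinearMap.BilinForm F V) (M : Set (Submodule F V)) : Prop where
  finrank_rad_le : ∀ U ∈ M, finrank F (rad s U) ≤ 1
  radFree : ∀ U ∈ M, ∀ W ∈ M, finrank F U < finrank F W → RadFree s U W
  eq : ∀ U ∈ M, ∀ W ∈ M, finrank F U = finrank F W → U = W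

/-- Take a maximal chain by Zorn. Around a missing dimension its nearest members differ by at least
two, so a subspace fits between them. By transitivity of incidence it is compatible with the whole
chain, against maximality. -/
theorem IsRadChain.exists_fullChain (hs : s.IsAlt) {E : Set (Submodule F V)}
    (hE : IsRadChain s E) (hbot : ⊥ ∈ E) (htop : ⊤ ∈ E) :
    ∃ C, IsFullChain s C ∧ ∀ U ∈ E, C (finrank F U) = U := by
  obtain ⟨M, hEM, hM⟩ := zorn_subset_nonempty {M | IsRadChain s M} (by
    intro c hc hchain hne
    refine ⟨⋃₀ c, ?_, fun M hM => Set.subset_sUnion_of_mem hM⟩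
    have key : ∀ U ∈ ⋃₀ c, ∀ W ∈ ⋃₀ c, ∃ M ∈ c, U ∈ M ∧ W ∈ M := by
      rintro U ⟨M, hM, hU⟩ W ⟨N, hN, hW⟩
      rcases hchain.total hM hN with h | h
      · exact ⟨N, hN, h hU, hW⟩
      · exact ⟨M, hM, hU, h hW⟩
    refine ⟨?_, ?_, ?_⟩
    · rintro U ⟨M, hM, hU⟩
      exact (hc hM).finrank_rad_le U hU
    · intro U hU W hW
      obtain ⟨M, hM, h1, h2⟩ := key U hU W hW
      exact (hc hM).radFree U h1 W h2
    · intro U hU W hW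
      obtain ⟨M, hM, h1, h2⟩ := key U hU W hW
      exact (hc hM).eq U h1 W h2) E hE
  have hMc : IsRadChain s M := hM.prop
  have hall : ∀ d ≤ finrank F V, ∃ U ∈ M, finrank F U = d := by
    intro d hd
    by_contra! hno
    classical
    let i := Nat.findGreatest (fun i => ∃ U ∈ M, finrank F U = i) d
    obtain ⟨X, hX, hXi⟩ : ∃ U ∈ M, finrank F U = i :=
      Nat.findGreatest_spec (P := fun i => ∃ U ∈ M, finrank F U = i) (Nat.zero_le d)
        ⟨⊥, hEM hbot, finrank_bot F V⟩
    have hid : i ≤ d := Nat.findGreatest_le d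
    have hiM : ∀ U ∈ M, finrank F U ≤ d → finrank F U ≤ i := fun U hU hUd =>
      Nat.le_findGreatest hUd ⟨U, hU, rfl⟩
    have hhigh : ∃ j, d ≤ j ∧ ∃ U ∈ M, finrank F U = j :=
      ⟨_, hd, ⊤, hEM htop, finrank_top F V⟩
    obtain ⟨hdj, Y, hY, hYj⟩ := Nat.find_spec hhigh
    have hjM : ∀ U ∈ M, d ≤ finrank F U → Nat.find hhigh ≤ finrank F U := fun U hU hUd =>
      Nat.find_min' hhigh ⟨hUd, U, hU, rfl⟩
    have hXd : finrank F X ≠ d := hno X hX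
    have hYd : finrank F Y ≠ d := hno Y hY
    obtain ⟨Z, hXZ, hZY, hZ, hZd⟩ := (hMc.radFree X hX Y hY (by omega)).exists_between hs
      (hMc.finrank_rad_le X hX) (hMc.finrank_rad_le Y hY) (by omega)
    have hside : ∀ U ∈ M, (finrank F U < finrank F Z ∧ RadFree s U Z) ∨
        (finrank F Z < finrank F U ∧ RadFree s Z U) := by
      intro U hU
      have hUd := hno U hU
      rcases lt_or_gt_of_ne hUd with h | h
      · have h1 := hiM U hU h.le
        refine Or.inl ⟨by omega, ?_⟩
        rcases h1.lt_or_eq with h2 | h2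
        · exact (hMc.radFree U hU X hX (by omega)).trans hXZ
        · rw [hMc.eq U hU X hX (by omega)]
          exact hXZ
      · have h1 := hjM U hU h.le
        refine Or.inr ⟨by omega, ?_⟩
        rcases h1.lt_or_eq with h2 | h2
        · exact hZY.trans (hMc.radFree Y hY U hU (by omega))
        · rw [← hMc.eq Y hY U hU (by omega)]
          exact hZY
    have hins : IsRadChain s (insert Z M) := by
      refine ⟨?_, ?_, ?_⟩
      · rintro U (rfl | hU)
        · exact hZ
        · exact hMc.finrank_rad_le U hU
      · rintro U (rfl | hU) W (rfl | hW) hlt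
        · omega
        · rcases hside W hW with h | h
          · omega
          · exact h.2
        · rcases hside U hU with h | h
          · exact h.2
          · omega
        · exact hMc.radFree U hU W hW hlt
      · rintro U (rfl | hU) W (rfl | hW) hlt
        · rfl
        · rcases hside W hW with h | h <;> omega
        · rcases hside U hU with h | h <;> omega
        · exact hMc.eq U hU W hW hlt
    have hZM : Z ∈ M := hM.le_of_ge hins (Set.subset_insert Z M) (Set.mem_insert Z M)
    rcases hside Z hZM with h | h <;> omega
  choose! C hCM hCd using hall
  refine ⟨C, ⟨hCd, fun i hi => hMc.finrank_rad_le _ (hCM i hi), fun i j hij hj => ?_⟩, ?_⟩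
  · exact hMc.radFree _ (hCM i (by omega)) _ (hCM j hj)
      (by rw [hCd i (by omega), hCd j hj]; exact hij)
  · intro U hU
    have hle := finrank_le U
    exact hMc.eq _ (hCM _ hle) U (hEM hU) (hCd _ hle)

end LinearAlgebra
-- Intervals of the incidence order.
section Intervals

open Submodule Module

variable {F V : Type*} [Field F] [AddCommGroup V] [Module F V]

/-- The partial order which underlies incidence of subspaces of maximal rank. -/
def RadLe (s : LinearMap.BilinForm F V) (U W : Submodule F V) : Prop :=
  U = W ∨ RadFree s U W

/-- The subspaces of maximal rank strictly between `A` and `B`. -/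
def Interval (s : LinearMap.BilinForm F V) (A B : Submodule F V) : Set (Submodule F V) :=
  {U | finrank F A < finrank F U ∧ finrank F U < finrank F B ∧ finrank F (rad s U) ≤ 1 ∧
    RadFree s A U ∧ RadFree s U B}

variable {s : LinearMap.BilinForm F V}

theorem RadLe.le {U W : Submodule F V} (h : RadLe s U W) : U ≤ W := by
  rcases h with rfl | h
  · exact le_rfl
  · exact h.1

theorem RadLe.trans {U W X : Submodule F V} (h : RadLe s U W) (h' : RadLe s W X) :
    RadLe s U X := by
  rcases h with rfl | h
  · exact h'
  · rcases h' with rfl | h'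
    · exact Or.inr h
    · exact Or.inr (h.trans h')

theorem notMem_rad_of_apply_ne_zero {B : Submodule F V} {x y : V} (hx : x ∈ B)
    (h : s x y ≠ 0) : y ∉ rad s B := fun hy => h (hy.2 x hx)

/-- The vectors of `B ∩ A^⊥` outside the radical of `B`. -/
abbrev OrthVec (s : LinearMap.BilinForm F V) (A B : Submodule F V) : Type _ :=
  {x : V // x ∈ B ∧ (∀ a ∈ A, s a x = 0) ∧ x ∉ rad s B}

theorem OrthVec.notMem {A B : Submodule F V} (hb : rad s A = ⊥) (x : OrthVec s A B) : x.1 ∉ A := fun hx =>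
  x.2.2.2 (by rw [(rad_eq_bot_iff.1 hb).eq_zero hx x.2.2.1]; exact zero_mem _)

theorem disjoint_sup_singleton_rad {B P M : Submodule F V} {w : V} (hP : rad s P = ⊥) (hPB : P ≤ B)
    (hPM : P ≤ M) (hBM : rad s B ≤ M) (hw : w ∉ M) : Disjoint (P ⊔ F ∙ w) (rad s B) := by
  refine disjoint_def.2 fun v hv hvB => ?_
  obtain ⟨l, hl, t, rfl⟩ := mem_sup_singleton.1 hv
  by_cases ht : t = 0
  · subst ht
    rw [zero_smul, add_zero] at hvB ⊢
    exact disjoint_def.1 (RadFree.of_rad_eq_bot hP hPB).2 l hl hvB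
  · refine absurd ?_ hw
    have h1 : t • w ∈ M := by simpa using sub_mem (hBM hvB) (hPM hl)
    exact (smul_mem_iff _ ht).1 h1

/-- In the vector `z + β z' + (o + δ i)`, the perpendicularities make the pairings with `o` and `i`
depend on `β` only, and those with `z` and `z'` on `δ` only. Each scalar has to avoid two values. -/
theorem exists_common_neighbour (hF : ∀ a b : F, ∃ t, t ≠ a ∧ t ≠ b) (hs : s.IsAlt)
    {o i z z' : V} (h2 : s i z ≠ 0) (h3 : s o z' ≠ 0) (h4 : s i z' ≠ 0)
    (hoi : s o i = 0) (hzz : s z z' = 0) :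
    ∃ β δ : F, s o (z + β • z' + (o + δ • i)) ≠ 0 ∧ s i (z + β • z' + (o + δ • i)) ≠ 0 ∧
      s z (z + β • z' + (o + δ • i)) ≠ 0 ∧ s z' (z + β • z' + (o + δ • i)) ≠ 0 := by
  obtain ⟨β, hβ1, hβ2⟩ := hF (-(s o z) / s o z') (-(s i z) / s i z')
  obtain ⟨δ, hδ1, hδ2⟩ := hF (-(s z o) / s z i) (-(s z' o) / s z' i)
  have h2' : s z i ≠ 0 := fun h => h2 (IsAlt_swap hs h)
  have h4' : s z' i ≠ 0 := fun h => h4 (IsAlt_swap hs h)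
  refine ⟨β, δ, fun h => hβ1 ?_, fun h => hβ2 ?_, fun h => hδ1 ?_, fun h => hδ2 ?_⟩ <;>
    simp only [map_add, map_smul, smul_eq_mul, hs.self_eq_zero, hoi, hzz, IsAlt_swap hs hoi,
      IsAlt_swap hs hzz, mul_zero, add_zero, zero_add] at h
  · rw [eq_div_iff h3]
    linear_combination h
  · rw [eq_div_iff h4]
    linear_combination h
  · rw [eq_div_iff h2']
    linear_combination h
  · rw [eq_div_iff h4']
    linear_combination h

variable [FiniteDimensional F V]

theorem finrank_lt_of_mem {A L : Submodule F V} (h : A ≤ L) {x : V} (hx : x ∈ L) (hxA : x ∉ A) :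
    finrank F A < finrank F L :=
  finrank_lt_finrank_of_lt (lt_of_le_of_ne h fun he => hxA (he ▸ hx))

theorem finrank_sup_pair_le (A : Submodule F V) (x y : V) :
    finrank F ↥(A ⊔ F ∙ x ⊔ F ∙ y) ≤ finrank F A + 2 :=
  (finrank_sup_singleton_le _ _).trans (Nat.add_le_add_right (finrank_sup_singleton_le _ _) 1)

theorem finrank_sup_triple_le (A : Submodule F V) (x y z : V) :
    finrank F ↥(A ⊔ F ∙ x ⊔ F ∙ y ⊔ F ∙ z) ≤ finrank F A + 3 :=
  (finrank_sup_singleton_le _ _).trans (Nat.add_le_add_right (finrank_sup_pair_le _ _ _) 1)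

theorem exists_mem_inf_orthogonal (hs : s.IsAlt) {A U : Submodule F V} (hb : rad s A = ⊥)
    (hAU : A ≤ U) {x : V} (hx : x ∈ U) (hxA : ∀ a ∈ A, s a x = 0) (hxU : x ∉ rad s U) :
    ∃ u ∈ U ⊓ s.orthogonal A, s x u ≠ 0 := by
  have h1 : ∃ y ∈ U, s x y ≠ 0 := by
    by_contra! h
    exact hxU ⟨hx, fun y hy => IsAlt_swap hs (h y hy)⟩
  obtain ⟨y, hy, hxy⟩ := h1
  obtain ⟨w, hw, hw'⟩ := exists_sub_orthogonal hb y
  refine ⟨y - w, ⟨sub_mem hy (hAU hw), hw'⟩, ?_⟩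
  rwa [map_sub, IsAlt_swap hs (hxA w hw), sub_zero]

/-! ### Intervals above a nondegenerate subspace. -/

section NondegenerateBottom

variable {A B : Submodule F V}

theorem OrthVec.exists_apply_ne_zero (hs : s.IsAlt) (hb : rad s A = ⊥) (hAB : A ≤ B)
    (x : OrthVec s A B) : ∃ u ∈ B ⊓ s.orthogonal A, s x u ≠ 0 :=
  exists_mem_inf_orthogonal hs hb hAB x.2.1 x.2.2.1 x.2.2.2

theorem OrthVec.rad_join (hs : s.IsAlt) (hb : rad s A = ⊥) {x y : OrthVec s A B}
    (h : s x y ≠ 0) : rad s (A ⊔ F ∙ x.1 ⊔ F ∙ y.1) = ⊥ := by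
  refine rad_sup_singleton_eq_bot hs (finrank_rad_sup_singleton_le hb _) (r := x)
    ⟨self_mem_sup_singleton _ _, fun v hv => ?_⟩ h
  obtain ⟨a, ha, t, rfl⟩ := mem_sup_singleton.1 hv
  change s (a + t • x.1) x = 0
  rw [map_add, map_smul, LinearMap.add_apply, LinearMap.smul_apply, x.2.2.1 a ha,
    hs.self_eq_zero, smul_zero, add_zero]

/-- The points of the interval between a nondegenerate `A` and `B`. -/
def nondegGraph (hs : s.IsAlt) (hb : rad s A = ⊥) (hAB : A ≤ B)
    (hd : finrank F A + 3 ≤ finrank F B) :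
    PointGraph (Interval s A B) (RadLe s) (OrthVec s A B) where
  pt x := A ⊔ F ∙ x.1
  join x y := A ⊔ F ∙ x.1 ⊔ F ∙ y.1
  adj x y := s x y ≠ 0
  pt_mem x := by
    have := finrank_sup_singleton_le A x.1
    exact ⟨finrank_lt_of_mem le_sup_left (self_mem_sup_singleton _ _) (x.notMem hb), by omega,
      finrank_rad_sup_singleton_le hb _, RadFree.of_rad_eq_bot hb le_sup_left,
      radFree_sup_singleton hb hAB x.2.1 x.2.2.1 x.2.2.2⟩
  join_mem {x y} h := by
    have := finrank_sup_pair_le A x.1 y.1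
    have hr := OrthVec.rad_join hs hb h
    refine ⟨finrank_lt_of_mem (le_sup_left.trans le_sup_left) (self_mem_sup_singleton _ _)
      (y.notMem hb), by omega, by rw [hr, finrank_bot]; exact zero_le_one,
      RadFree.of_rad_eq_bot hb (le_sup_left.trans le_sup_left), RadFree.of_rad_eq_bot hr
      (sup_singleton_le (sup_singleton_le hAB x.2.1) y.2.1)⟩
  pt_le h := Or.inr ((rad_eq_bot_iff.1 (OrthVec.rad_join hs hb h)).mono le_sup_left)
  adj_symm h h' := h (IsAlt_swap hs h')
  join_comm x y := sup_right_comm _ _ _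
  exists_pt_le U hU := by
    obtain ⟨h1, h2, h3, h4, h5⟩ := hU
    by_cases hUd : finrank F A + 2 ≤ finrank F U
    · obtain ⟨z, hz, hzA, hzU⟩ := exists_orthogonal_notMem_rad h4.1 hb h3 hUd
      refine ⟨⟨z, h5.1 hz, hzA, fun hzB => hzU ⟨hz, fun y hy => hzB.2 y (h5.1 hy)⟩⟩,
        Or.inr (radFree_sup_singleton hb h4.1 hz hzA hzU)⟩
    · obtain ⟨y, hy, hyA⟩ := exists_mem_notMem h1
      obtain ⟨w, hw, hw'⟩ := exists_sub_orthogonal hb y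
      have hz : y - w ∈ U := sub_mem hy (h4.1 hw)
      have hzA : y - w ∉ A := fun h => hyA (by simpa using add_mem h hw)
      refine ⟨⟨y - w, h5.1 hz, hw', fun hzB => hzA ?_⟩, Or.inl ?_⟩
      · rw [disjoint_def.1 h5.2 _ hz hzB]
        exact zero_mem _
      · exact sup_singleton_eq h4.1 hz hzA (by omega)
  exists_adj x y := by
    obtain ⟨u, hu, h1, h2⟩ := exists_apply_ne_zero₂ (x.exists_apply_ne_zero hs hb hAB)
      (y.exists_apply_ne_zero hs hb hAB)
    exact ⟨⟨u, hu.1, hu.2, notMem_rad_of_apply_ne_zero x.2.1 h1⟩, h1, h2⟩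

/-- Vectors of the same point are proportional, so they have the same neighbours with the same
joins. For two different points below `U` neither vector is in `Rad(U)`, so some vector of `U ∩ A^⊥`
is perpendicular to neither, and it joins them inside `U`. -/
theorem nondegGraph_link (hs : s.IsAlt) (hb : rad s A = ⊥) (hAB : A ≤ B)
    (hd : finrank F A + 3 ≤ finrank F B) {U : Submodule F V} (hU : U ∈ Interval s A B)
    (x y : OrthVec s A B) (hx : RadLe s (A ⊔ F ∙ x.1) U) (hy : RadLe s (A ⊔ F ∙ y.1) U) :
    Relation.EqvGen ((nondegGraph hs hb hAB hd).Link U) x y := by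
  have hdim : ∀ z : OrthVec s A B, finrank F ↥(A ⊔ F ∙ z.1) = finrank F A + 1 := fun z =>
    le_antisymm (finrank_sup_singleton_le A z.1)
      (finrank_lt_of_mem le_sup_left (self_mem_sup_singleton _ _) (z.notMem hb))
  by_cases he : A ⊔ F ∙ x.1 = A ⊔ F ∙ y.1
  · obtain ⟨u, hu, hxu⟩ := x.exists_apply_ne_zero hs hb hAB
    have hmem : y.1 ∈ A ⊔ F ∙ x.1 := by
      rw [he]
      exact self_mem_sup_singleton _ _
    obtain ⟨a, ha, t, hat⟩ := mem_sup_singleton.1 hmem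
    have ha0 : a = 0 := (rad_eq_bot_iff.1 hb).eq_zero ha fun v hv => by
      have := y.2.2.1 v hv
      rwa [← hat, map_add, map_smul, x.2.2.1 v hv, smul_zero, add_zero] at this
    have ht : t ≠ 0 := by
      rintro rfl
      rw [ha0, zero_smul, add_zero] at hat
      exact y.2.2.2 (by rw [← hat]; exact zero_mem _)
    refine Relation.EqvGen.rel _ _ (Or.inr ⟨he, hx,
      ⟨u, hu.1, hu.2, notMem_rad_of_apply_ne_zero x.2.1 hxu⟩, hxu, ?_, ?_⟩)
    · change s y.1 u ≠ 0
      rw [← hat, ha0, zero_add, map_smul, LinearMap.smul_apply]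
      exact smul_ne_zero ht hxu
    · change A ⊔ F ∙ x.1 ⊔ F ∙ u = A ⊔ F ∙ y.1 ⊔ F ∙ u
      rw [he]
  · have key : ∀ x y : OrthVec s A B, A ⊔ F ∙ x.1 ≠ A ⊔ F ∙ y.1 → RadLe s (A ⊔ F ∙ x.1) U →
        RadLe s (A ⊔ F ∙ y.1) U → ∃ u ∈ U ⊓ s.orthogonal A, s x u ≠ 0 := by
      intro x y he hx hy
      have hxU : x.1 ∈ U := hx.le (self_mem_sup_singleton _ _)
      refine exists_mem_inf_orthogonal hs hb hU.2.2.2.1.1 hxU x.2.2.1 fun hxr => ?_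
      rcases hx with hx | hx
      · refine he (eq_of_le_of_finrank_le ?_ ?_).symm
        · rw [hx]
          exact hy.le
        · rw [hdim, hdim]
      · refine x.2.2.2 ?_
        rw [disjoint_def.1 hx.2 x.1 (self_mem_sup_singleton _ _) hxr]
        exact zero_mem _
    obtain ⟨u, hu, h1, h2⟩ := exists_apply_ne_zero₂ (key x y he hx hy)
      (key y x (Ne.symm he) hy hx)
    let z : OrthVec s A B := ⟨u, hU.2.2.2.2.1 hu.1, hu.2, notMem_rad_of_apply_ne_zero x.2.1 h1⟩
    have hL : ∀ w : OrthVec s A B, RadLe s (A ⊔ F ∙ w.1) U → s w u ≠ 0 →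
        RadLe s (A ⊔ F ∙ w.1 ⊔ F ∙ u) U := fun w hw hwu =>
      Or.inr (RadFree.of_rad_eq_bot (OrthVec.rad_join hs hb (y := z) hwu)
        (sup_singleton_le hw.le hu.1))
    exact (Relation.EqvGen.rel x z (Or.inl ⟨h1, hL x hx h1⟩)).trans _ _ _
      ((Relation.EqvGen.rel y z (Or.inl ⟨h2, hL y hy h2⟩)).symm _ _)

/-- The span of a triangle has radical of dimension at most one, as it extends a nondegenerate join
by one vector. The only obstruction to being an object of the interval is its intersection with
`Rad(B)`. -/
theorem nondegGraph_bounded (hs : s.IsAlt) (hb : rad s A = ⊥) (hAB : A ≤ B)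
    (hd : finrank F A + 3 ≤ finrank F B) (hd' : finrank F A + 4 ≤ finrank F B)
    {x y z : OrthVec s A B} (hxy : s x y ≠ 0) (hyz : s y z ≠ 0) (hxz : s x z ≠ 0)
    (hM : Disjoint (A ⊔ F ∙ x.1 ⊔ F ∙ y.1 ⊔ F ∙ z.1) (rad s B)) :
    (nondegGraph hs hb hAB hd).Bounded x y z := by
  have hdim := finrank_sup_triple_le A x.1 y.1 z.1
  have hx : x.1 ∈ A ⊔ F ∙ x.1 ⊔ F ∙ y.1 ⊔ F ∙ z.1 :=
    mem_sup_left (mem_sup_left (self_mem_sup_singleton _ _))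
  have hy : y.1 ∈ A ⊔ F ∙ x.1 ⊔ F ∙ y.1 ⊔ F ∙ z.1 := mem_sup_left (self_mem_sup_singleton _ _)
  have hz : z.1 ∈ A ⊔ F ∙ x.1 ⊔ F ∙ y.1 ⊔ F ∙ z.1 := self_mem_sup_singleton _ _
  have hA : A ≤ A ⊔ F ∙ x.1 ⊔ F ∙ y.1 ⊔ F ∙ z.1 :=
    le_sup_left.trans (le_sup_left.trans le_sup_left)
  refine ⟨A ⊔ F ∙ x.1 ⊔ F ∙ y.1 ⊔ F ∙ z.1, ⟨finrank_lt_of_mem hA hx (x.notMem hb), by omega,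
    finrank_rad_sup_singleton_le (OrthVec.rad_join hs hb hxy) _,
    RadFree.of_rad_eq_bot hb hA, ?_, hM⟩, ?_, ?_, ?_⟩
  · exact sup_singleton_le (sup_singleton_le (sup_singleton_le hAB x.2.1) y.2.1) z.2.1
  · exact Or.inr (RadFree.of_rad_eq_bot (OrthVec.rad_join hs hb hxy) le_sup_left)
  · exact Or.inr (RadFree.of_rad_eq_bot (OrthVec.rad_join hs hb hyz)
      (sup_singleton_le (sup_singleton_le hA hy) hz))
  · exact Or.inr (RadFree.of_rad_eq_bot (OrthVec.rad_join hs hb hxz)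
      (sup_singleton_le (sup_singleton_le hA hx) hz))

/-- If the span `M` of the triangle meets `Rad(B)`, it contains it. A common neighbour `w` outside
`M` then forms with each edge a triangle whose span misses `Rad(B)`. -/
theorem nondegGraph_triangle (hF : ∀ a b : F, ∃ t, t ≠ a ∧ t ≠ b) (hs : s.IsAlt)
    (hb : rad s A = ⊥) (hAB : A ≤ B) (hB : finrank F (rad s B) ≤ 1)
    (hd : finrank F A + 3 ≤ finrank F B) (hd' : finrank F A + 4 ≤ finrank F B)
    {x y z : OrthVec s A B} (hxy : s x y ≠ 0) (hyz : s y z ≠ 0) (hxz : s x z ≠ 0) :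
    (nondegGraph hs hb hAB hd).Bounded x y z ∨ ∃ w : OrthVec s A B,
      s x w ≠ 0 ∧ s y w ≠ 0 ∧ s z w ≠ 0 ∧ (nondegGraph hs hb hAB hd).Bounded x y w ∧
      (nondegGraph hs hb hAB hd).Bounded y z w ∧ (nondegGraph hs hb hAB hd).Bounded x z w := by
  set M := A ⊔ F ∙ x.1 ⊔ F ∙ y.1 ⊔ F ∙ z.1 with hMdef
  by_cases hM : Disjoint M (rad s B)
  · exact Or.inl (nondegGraph_bounded hs hb hAB hd hd' hxy hyz hxz hM)
  right
  have hL := OrthVec.rad_join hs hb hxy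
  have hLB : A ⊔ F ∙ x.1 ⊔ F ∙ y.1 ≤ B := sup_singleton_le (sup_singleton_le hAB x.2.1) y.2.1
  have hMd : finrank F M < finrank F B := by
    exact lt_of_le_of_lt (finrank_sup_triple_le A x.1 y.1 z.1) (by omega)
  have hA : A ≤ M := le_sup_left.trans (le_sup_left.trans le_sup_left)
  have hxM : x.1 ∈ M := mem_sup_left (mem_sup_left (self_mem_sup_singleton _ _))
  have hyM : y.1 ∈ M := mem_sup_left (self_mem_sup_singleton _ _)
  have hzM : z.1 ∈ M := self_mem_sup_singleton _ _
  obtain ⟨ρ, hρM, hρB, hρ0⟩ : ∃ ρ ∈ M, ρ ∈ rad s B ∧ ρ ≠ 0 := by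
    by_contra! h
    exact hM (disjoint_def.2 h)
  have hBM : rad s B ≤ M := fun v hv => by
    obtain ⟨t, rfl⟩ := exists_smul_eq_of_finrank_le_one hB hρB hρ0 hv
    exact smul_mem _ _ hρM
  obtain ⟨w, hwB, hwA, h1, h2, h3, hwM⟩ : ∃ w ∈ B, (∀ a ∈ A, s a w = 0) ∧ s x w ≠ 0 ∧
      s y w ≠ 0 ∧ s z w ≠ 0 ∧ w ∉ M := by
    obtain ⟨w, hw, h1, h2, h3⟩ := exists_apply_ne_zero₃ hF (x.exists_apply_ne_zero hs hb hAB)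
      (y.exists_apply_ne_zero hs hb hAB) (z.exists_apply_ne_zero hs hb hAB)
    -- If `w` falls into `M`, shift it by `b - l`, which is outside `M` and perpendicular to the
    -- join of `x` and `y`. It is also perpendicular to `z`, because `ρ` in `Rad(B)` has a nonzero
    -- `z`-component, so all pairings survive.
    by_cases hwM : w ∈ M
    · obtain ⟨b, hbB, hbM⟩ := exists_mem_notMem hMd
      obtain ⟨l, hl, hl'⟩ := exists_sub_orthogonal hL b
      have hzu : s z (b - l) = 0 := by
        obtain ⟨l', hl'L, t, hlt⟩ := mem_sup_singleton.1 hρM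
        have ht : t ≠ 0 := by
          rintro rfl
          rw [zero_smul, add_zero] at hlt
          subst hlt
          exact hρ0 (disjoint_def.1 (RadFree.of_rad_eq_bot hL hLB).2 _ hl'L hρB)
        have h4 : s ρ (b - l) = 0 := IsAlt_swap hs (hρB.2 _ (sub_mem hbB (hLB hl)))
        rw [← hlt, map_add, LinearMap.add_apply, hl' l' hl'L, zero_add, map_smul,
          LinearMap.smul_apply] at h4
        exact (smul_eq_zero.1 h4).resolve_left ht
      refine ⟨w + (b - l), add_mem hw.1 (sub_mem hbB (hLB hl)), fun a ha => ?_, ?_, ?_, ?_, ?_⟩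
      · rw [map_add, hw.2 a ha, hl' a (mem_sup_left (mem_sup_left ha)), add_zero]
      · rwa [map_add, hl' x (mem_sup_left (self_mem_sup_singleton _ _)), add_zero]
      · rwa [map_add, hl' y (self_mem_sup_singleton _ _), add_zero]
      · rwa [map_add, hzu, add_zero]
      · intro hmem
        have hlM : l ∈ M := mem_sup_left hl
        refine hbM ?_
        have := add_mem (sub_mem hmem hwM) hlM
        rwa [add_sub_cancel_left, sub_add_cancel] at this
    · exact ⟨w, hw.1, hw.2, h1, h2, h3, hwM⟩
  refine ⟨⟨w, hwB, hwA, notMem_rad_of_apply_ne_zero x.2.1 h1⟩, h1, h2, h3, ?_, ?_, ?_⟩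
  · exact nondegGraph_bounded hs hb hAB hd hd' hxy h2 h1
      (disjoint_sup_singleton_rad hL hLB le_sup_left hBM hwM)
  · exact nondegGraph_bounded hs hb hAB hd hd' hyz h3 h2
      (disjoint_sup_singleton_rad (OrthVec.rad_join hs hb hyz)
      (sup_singleton_le (sup_singleton_le hAB y.2.1) z.2.1)
      (sup_singleton_le (sup_singleton_le hA hyM) hzM) hBM hwM)
  · exact nondegGraph_bounded hs hb hAB hd hd' hxz h3 h1
      (disjoint_sup_singleton_rad (OrthVec.rad_join hs hb hxz)
      (sup_singleton_le (sup_singleton_le hAB x.2.1) z.2.1)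
      (sup_singleton_le (sup_singleton_le hA hxM) hzM) hBM hwM)

theorem nondeg_cocyclesTrivial {H : Type*} [Group H] (hF : ∀ a b : F, ∃ t, t ≠ a ∧ t ≠ b)
    (hs : s.IsAlt) (hb : rad s A = ⊥) (hAB : A ≤ B) (hB : finrank F (rad s B) ≤ 1)
    (hd : finrank F A + 4 ≤ finrank F B) : CocyclesTrivial H (Interval s A B) (RadLe s) := by
  obtain ⟨x, hx, hxA, hxB⟩ := exists_orthogonal_notMem_rad hAB hb hB (by omega)
  have : Nonempty (OrthVec s A B) := ⟨⟨x, hx, hxA, hxB⟩⟩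
  have hd3 : finrank F A + 3 ≤ finrank F B := by omega
  refine (nondegGraph hs hb hAB hd3).cocyclesTrivial (fun _ _ _ _ _ _ => RadLe.trans) ?_ ?_
    (fun i j k hij hjk hik => nondegGraph_triangle hF hs hb hAB hB hd3 hd hij hjk hik)
    (fun U hU i j => nondegGraph_link hs hb hAB hd3 hU i j)
  · intro o i j _
    obtain ⟨w, hw, h1, h2, h3⟩ := exists_apply_ne_zero₃ hF (o.exists_apply_ne_zero hs hb hAB)
      (i.exists_apply_ne_zero hs hb hAB) (j.exists_apply_ne_zero hs hb hAB)
    exact ⟨⟨w, hw.1, hw.2, notMem_rad_of_apply_ne_zero o.2.1 h1⟩, h1, h2, h3⟩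
  · intro o i z z' h1 h2 h3 h4
    by_cases hoi : s o i = 0
    · by_cases hzz : s z z' = 0
      · obtain ⟨β, δ, h5, h6, h7, h8⟩ := exists_common_neighbour hF hs h2 h3 h4 hoi hzz
        refine Or.inr (Or.inr ⟨⟨_, ?_, ?_, notMem_rad_of_apply_ne_zero o.2.1 h5⟩, h5, h6, h7, h8⟩)
        · exact add_mem (add_mem z.2.1 (smul_mem _ _ z'.2.1)) (add_mem o.2.1 (smul_mem _ _ i.2.1))
        · intro a ha
          simp only [map_add, map_smul, z.2.2.1 a ha, z'.2.2.1 a ha, o.2.2.1 a ha, i.2.2.1 a ha,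
            smul_zero, add_zero]
      · exact Or.inr (Or.inl hzz)
    · exact Or.inl hoi

end NondegenerateBottom

end Intervals
-- Intervals above a degenerate subspace.
section DegenerateBottom

open Submodule Module

variable {F V : Type*} [Field F] [AddCommGroup V] [Module F V] {s : LinearMap.BilinForm F V}

/-- A multiple `c w` works: against `w'` the two conditions exclude one value of `c` each. It serves
to find a common neighbour of two points. -/
theorem exists_common_shift (hF : ∀ a b : F, ∃ t, t ≠ a ∧ t ≠ b) {D : Submodule F V} {w w' : V}
    (hw : w ∈ D) (hw' : w' ∈ D) (hww : s w w' ≠ 0) (v : V) :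
    ∃ y ∈ D, (∃ x ∈ D, s y x ≠ 0) ∧ ∃ x ∈ D, s (v + y) x ≠ 0 := by
  obtain ⟨c, hc0, hc⟩ := hF 0 (-(s v w') / s w w')
  refine ⟨c • w, smul_mem _ _ hw, ⟨w', hw', ?_⟩, w', hw', fun h => hc ?_⟩
  · rw [map_smul, LinearMap.smul_apply]
    exact smul_ne_zero hc0 hww
  · rw [eq_div_iff hww]
    simp only [map_add, map_smul, LinearMap.add_apply, LinearMap.smul_apply, smul_eq_mul] at h
    linear_combination h

/-- In an interval above a degenerate `A`: if `r` spans the radical of `A` and `x₀` is a vector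
which is not perpendicular to `r`, then two vectors of `x₀ + A^⊥` in `U` whose difference is not
in the radical of `U ∩ A^⊥` span with `A` a subspace incident with `U`. -/
theorem radFree_join {A U : Submodule F V} (hs : s.IsAlt) (hAU : RadFree s A U) {r x y : V}
    (hr : r ∈ rad s A) (hx : x ∈ U) (hy : y ∈ U) (hrx : s r x ≠ 0)
    (hrxy : s r y = s r x)
    (h : ∃ w ∈ U ⊓ s.orthogonal A, s (y - x) w ≠ 0) : RadFree s (A ⊔ F ∙ x ⊔ F ∙ y) U := by
  refine radFree_iff.2 ⟨sup_singleton_le (sup_singleton_le hAU.1 hx) hy, fun v hv hvU => ?_⟩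
  obtain ⟨v', hv', β, rfl⟩ := mem_sup_singleton.1 hv
  obtain ⟨a, ha, α, rfl⟩ := mem_sup_singleton.1 hv'
  obtain ⟨w, ⟨hwU, hwA⟩, hw⟩ := h
  have h1 := hvU r (hAU.1 hr.1)
  simp only [map_add, map_smul, IsAlt_swap hs (hr.2 a ha), hrxy, smul_eq_mul] at h1
  have hα : α = -β := by
    have h2 : (α + β) * s r x = 0 := by linear_combination h1
    exact eq_neg_of_add_eq_zero_left ((mul_eq_zero.1 h2).resolve_right hrx)
  subst hα
  have h3 := IsAlt_swap hs (hvU w hwU)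
  have h4 : s a w = 0 := hwA a ha
  simp only [map_add, map_smul, LinearMap.add_apply, LinearMap.smul_apply, h4, smul_eq_mul] at h3
  have hβ : β = 0 := by
    have h2 : β * s (y - x) w = 0 := by
      rw [map_sub, LinearMap.sub_apply]
      linear_combination h3
    exact (mul_eq_zero.1 h2).resolve_right hw
  subst hβ
  rw [neg_zero, zero_smul, zero_smul, add_zero, add_zero] at hvU ⊢
  exact hAU.eq_zero ha hvU

/-- The data of a degenerate subspace `A` incident with `B`, a vector `r` in the radical of `A`
and a vector `x₀` of `B` which is not perpendicular to `r`. -/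
structure DegenerateData (s : LinearMap.BilinForm F V) (A B : Submodule F V) where
  /-- A vector in the radical of `A`. -/
  r : V
  /-- The origin of the affine space of points. -/
  x₀ : V
  isAlt : s.IsAlt
  finrank_rad_le : finrank F (rad s A) ≤ 1
  finrank_rad_le' : finrank F (rad s B) ≤ 1
  radFree : RadFree s A B
  r_mem : r ∈ rad s A
  x₀_mem : x₀ ∈ B
  ne_zero : s r x₀ ≠ 0

theorem exists_degenerateData (hs : s.IsAlt) {A B : Submodule F V}
    (hA : finrank F (rad s A) ≤ 1) (hB : finrank F (rad s B) ≤ 1) (hAB : RadFree s A B)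
    (hb : rad s A ≠ ⊥) : Nonempty (DegenerateData s A B) := by
  obtain ⟨r, hr, hr0⟩ := exists_mem_ne_zero_of_ne_bot hb
  obtain ⟨y, hy, hry⟩ := hAB.exists_apply_ne_zero hs hr.1 hr0
  exact ⟨⟨r, y, hs, hA, hB, hAB, hr, hy, hry⟩⟩

namespace DegenerateData

variable {A B : Submodule F V} (D : DegenerateData s A B)

/-- The points of the interval, as translations of the origin. -/
abbrev Point (_D : DegenerateData s A B) : Type _ := ↥(B ⊓ s.orthogonal A)

/-- The subspace which belongs to a point. -/
abbrev pt (d : D.Point) : Submodule F V := A ⊔ F ∙ (D.x₀ + d.1)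

theorem apply_add {d : V} (hd : d ∈ s.orthogonal A) : s D.r (D.x₀ + d) = s D.r D.x₀ := by
  have : s D.r d = 0 := hd _ D.r_mem.1
  rw [map_add, this, add_zero]

theorem apply_add_ne {d : V} (hd : d ∈ s.orthogonal A) : s D.r (D.x₀ + d) ≠ 0 := by
  rw [D.apply_add hd]
  exact D.ne_zero

theorem notMem {x : V} (hx : s D.r x ≠ 0) : x ∉ A := fun h =>
  hx (IsAlt_swap D.isAlt (D.r_mem.2 x h))

theorem add_mem_right (d : D.Point) : D.x₀ + d.1 ∈ B := add_mem D.x₀_mem d.2.1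

/-- Adjacency of points. -/
def Adj (d d' : D.Point) : Prop := ∃ w ∈ B ⊓ s.orthogonal A, s (d'.1 - d.1) w ≠ 0

/-- The subspace spanned by two points. -/
abbrev join (d d' : D.Point) : Submodule F V := A ⊔ F ∙ (D.x₀ + d.1) ⊔ F ∙ (D.x₀ + d'.1)

theorem radFree_join_of {U : Submodule F V} (hU : RadFree s A U) (d d' : D.Point)
    (hd : D.x₀ + d.1 ∈ U) (hd' : D.x₀ + d'.1 ∈ U)
    (h : ∃ w ∈ U ⊓ s.orthogonal A, s (d'.1 - d.1) w ≠ 0) : RadFree s (D.join d d') U :=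
  radFree_join D.isAlt hU D.r_mem hd hd' (D.apply_add_ne d.2.2)
    (by rw [D.apply_add d.2.2, D.apply_add d'.2.2]) (by simpa using h)

theorem adj_symm {d d' : D.Point} (h : D.Adj d d') : D.Adj d' d := by
  obtain ⟨w, hw, h⟩ := h
  exact ⟨w, hw, by rwa [← neg_sub, map_neg, LinearMap.neg_apply, neg_ne_zero]⟩

variable [FiniteDimensional F V]

theorem rad_sup {x : V} (hx : s D.r x ≠ 0) : rad s (A ⊔ F ∙ x) = ⊥ :=
  rad_sup_singleton_eq_bot D.isAlt D.finrank_rad_le D.r_mem hx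

theorem rad_pt (d : D.Point) : rad s (D.pt d) = ⊥ := D.rad_sup (D.apply_add_ne d.2.2)

theorem finrank_pt (d : D.Point) : finrank F (D.pt d) = finrank F A + 1 :=
  le_antisymm (finrank_sup_singleton_le _ _) (finrank_lt_of_mem le_sup_left
    (self_mem_sup_singleton _ _) (D.notMem (D.apply_add_ne d.2.2)))

/-- Large subspaces incident with `A` contain non-perpendicular vectors of `A^⊥`. -/
theorem exists_orthogonal_pair {U : Submodule F V} (hU : finrank F (rad s U) ≤ 1)
    {x : V} (hAU : A ≤ U) (hx : x ∈ U) (hrx : s D.r x ≠ 0)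
    (hd : finrank F A + 3 ≤ finrank F U) :
    ∃ w ∈ U ⊓ s.orthogonal A, ∃ w' ∈ U ⊓ s.orthogonal A, s w w' ≠ 0 := by
  have hN := D.rad_sup hrx
  have hNU : A ⊔ F ∙ x ≤ U := sup_singleton_le hAU hx
  have := finrank_sup_singleton_le A x
  obtain ⟨z, hz, hzN, hzU⟩ := exists_orthogonal_notMem_rad hNU hN hU (by omega)
  obtain ⟨u, hu, hzu⟩ := exists_mem_inf_orthogonal D.isAlt hN hNU hz hzN hzU
  exact ⟨z, ⟨hz, fun a ha => hzN a (mem_sup_left ha)⟩, u,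
    ⟨hu.1, fun a ha => hu.2 a (mem_sup_left ha)⟩, hzu⟩

/-- The radical of `B ∩ A^⊥`. -/
theorem exists_eq_add_of_orthogonal (D : DegenerateData s A B) {u : V} (hu : u ∈ B ⊓ s.orthogonal A)
    (h : ∀ w ∈ B ⊓ s.orthogonal A, s u w = 0) : ∃ a ∈ A, ∃ ρ ∈ rad s B, u = a + ρ := by
  have hN := D.rad_sup D.ne_zero
  have hNB : A ⊔ F ∙ D.x₀ ≤ B := sup_singleton_le D.radFree.1 D.x₀_mem
  obtain ⟨n, hn, hn'⟩ := exists_sub_orthogonal hN u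
  obtain ⟨a, ha, t, rfl⟩ := mem_sup_singleton.1 hn
  have h1 := hn' D.r (mem_sup_left D.r_mem.1)
  have h2 : s D.r u = 0 := hu.2 _ D.r_mem.1
  simp only [map_sub, map_add, map_smul, h2, IsAlt_swap D.isAlt (D.r_mem.2 a ha), zero_add,
    zero_sub, smul_eq_mul, neg_eq_zero] at h1
  have ht : t = 0 := (mul_eq_zero.1 h1).resolve_right D.ne_zero
  subst ht
  rw [zero_smul, add_zero] at hn'
  refine ⟨a, ha, u - a, ⟨sub_mem hu.1 (D.radFree.1 ha), fun b hb => ?_⟩, by abel⟩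
  -- Split `b` along the nondegenerate `A + ⟨x₀⟩`: the remainder lies in `B ∩ A^⊥`, where `h`
  -- applies, and `m` is perpendicular to `u - a` by construction.
  obtain ⟨m, hm, hm'⟩ := exists_sub_orthogonal hN b
  have hbm : b - m ∈ B ⊓ s.orthogonal A :=
    ⟨sub_mem hb (hNB hm), fun a ha => hm' a (mem_sup_left ha)⟩
  have h3 : s (b - m) (u - a) = 0 := by
    rw [map_sub, IsAlt_swap D.isAlt (h _ hbm), IsAlt_swap D.isAlt (hbm.2 a ha), sub_zero]
  have h4 := hn' m hm
  change s b (u - a) = 0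
  rwa [LinearMap.map_sub₂, h4, sub_zero] at h3

theorem rad_join_le (d d' : D.Point) : finrank F (rad s (D.join d d')) ≤ 1 :=
  finrank_rad_sup_singleton_le (D.rad_pt d) _

/-- A vector of `U` not perpendicular to `r` is rescaled to have the same pairing with `r` as `x₀`.
Projecting the difference to `A + ⟨x⟩` then involves no multiple of `x`, so a correction from `A`
alone moves it into `x₀ + A^⊥`. -/
theorem exists_pt_le {U : Submodule F V} (hU : U ∈ Interval s A B) :
    ∃ d : D.Point, RadFree s (D.pt d) U := by
  obtain ⟨h1, h2, h3, h4, h5⟩ := hU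
  have hr0 : D.r ≠ 0 := fun h => D.ne_zero (by rw [h, map_zero, LinearMap.zero_apply])
  obtain ⟨y, hy, hry⟩ := h4.exists_apply_ne_zero D.isAlt D.r_mem.1 hr0
  set x := (s D.r D.x₀ / s D.r y) • y with hxdef
  have hx : x ∈ U := smul_mem _ _ hy
  have hrx : s D.r x = s D.r D.x₀ := by
    rw [hxdef, map_smul, smul_eq_mul, div_mul_cancel₀ _ hry]
  have hrx0 : s D.r x ≠ 0 := by rw [hrx]; exact D.ne_zero
  obtain ⟨n, hn, hn'⟩ := exists_sub_orthogonal (D.rad_sup hrx0) (D.x₀ - x)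
  obtain ⟨a, ha, t, rfl⟩ := mem_sup_singleton.1 hn
  have h6 := hn' D.r (mem_sup_left D.r_mem.1)
  simp only [map_sub, map_add, map_smul, hrx, IsAlt_swap D.isAlt (D.r_mem.2 a ha), zero_add,
    sub_self, zero_sub, smul_eq_mul, neg_eq_zero] at h6
  have ht : t = 0 := (mul_eq_zero.1 h6).resolve_right D.ne_zero
  subst ht
  rw [zero_smul, add_zero] at hn'
  have hxa : x + a ∈ U := add_mem hx (h4.1 ha)
  have hd : x + a - D.x₀ ∈ B ⊓ s.orthogonal A := by
    refine ⟨sub_mem (h5.1 hxa) D.x₀_mem, fun a' ha' => ?_⟩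
    have h7 := hn' a' (mem_sup_left ha')
    change s a' (x + a - D.x₀) = 0
    rw [show x + a - D.x₀ = -(D.x₀ - x - a) by abel, map_neg, h7, neg_zero]
  refine ⟨⟨_, hd⟩, RadFree.of_rad_eq_bot (D.rad_pt _) (sup_singleton_le h4.1 ?_)⟩
  change D.x₀ + (x + a - D.x₀) ∈ U
  rwa [add_sub_cancel]

theorem exists_adj (hF : ∀ a b : F, ∃ t, t ≠ a ∧ t ≠ b) (hd : finrank F A + 3 ≤ finrank F B)
    (d d' : D.Point) : ∃ z : D.Point, D.Adj d z ∧ D.Adj d' z := by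
  obtain ⟨w, hw, w', hw', hww⟩ := D.exists_orthogonal_pair D.finrank_rad_le' D.radFree.1 D.x₀_mem
    D.ne_zero hd
  obtain ⟨y, hy, h1, h2⟩ := exists_common_shift hF hw hw' hww (d.1 - d'.1)
  refine ⟨d + ⟨y, hy⟩, ?_, ?_⟩
  · simpa [Adj] using h1
  · simpa [Adj, sub_add_eq_add_sub] using h2

/-- The points of the interval between a degenerate `A` and `B`. -/
def graph (hF : ∀ a b : F, ∃ t, t ≠ a ∧ t ≠ b) (hd : finrank F A + 3 ≤ finrank F B) :
    PointGraph (Interval s A B) (RadLe s) D.Point where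
  pt := D.pt
  join := D.join
  adj := D.Adj
  pt_mem d := by
    have := D.finrank_pt d
    refine ⟨by omega, by omega, by rw [D.rad_pt d, finrank_bot]; exact zero_le_one,
      (rad_eq_bot_iff.1 (D.rad_pt d)).mono le_sup_left, RadFree.of_rad_eq_bot (D.rad_pt d)
        (sup_singleton_le D.radFree.1 (D.add_mem_right d))⟩
  join_mem {d d'} h := by
    have h1 := finrank_sup_pair_le A (D.x₀ + d.1) (D.x₀ + d'.1)
    refine ⟨finrank_lt_of_mem (le_sup_left.trans le_sup_left)
      (self_mem_sup_singleton _ _) (D.notMem (D.apply_add_ne d'.2.2)),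
      lt_of_le_of_lt h1 (by omega),
      D.rad_join_le d d', ((rad_eq_bot_iff.1 (D.rad_pt d)).mono le_sup_left).of_le le_sup_left,
      D.radFree_join_of D.radFree d d' (D.add_mem_right d) (D.add_mem_right d') h⟩
  pt_le {d d'} _ := Or.inr (RadFree.of_rad_eq_bot (D.rad_pt d) le_sup_left)
  adj_symm := D.adj_symm
  join_comm _ _ := sup_right_comm _ _ _
  exists_pt_le U hU := (D.exists_pt_le hU).imp fun _ h => Or.inr h
  exists_adj := D.exists_adj hF hd

/-- When `dim U ≥ dim A + 3`, the space `U ∩ A^⊥` contains a nonperpendicular pair, hence a common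
neighbour of the two points inside `U`. In smaller `U`, either the points coincide or they are
adjacent with join `U`. -/
theorem graph_link (hF : ∀ a b : F, ∃ t, t ≠ a ∧ t ≠ b) (hd : finrank F A + 3 ≤ finrank F B)
    {U : Submodule F V} (hU : U ∈ Interval s A B) (d d' : D.Point)
    (hdU : RadLe s (D.pt d) U) (hdU' : RadLe s (D.pt d') U) :
    Relation.EqvGen ((D.graph hF hd).Link U) d d' := by
  obtain ⟨h1, h2, h3, h4, h5⟩ := hU
  have hxd : D.x₀ + d.1 ∈ U := hdU.le (self_mem_sup_singleton _ _)
  have hxd' : D.x₀ + d'.1 ∈ U := hdU'.le (self_mem_sup_singleton _ _)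
  have hu : d'.1 - d.1 ∈ U := by simpa using sub_mem hxd' hxd
  by_cases hpair : finrank F A + 3 ≤ finrank F U
  · obtain ⟨w, hw, w', hw', hww⟩ := D.exists_orthogonal_pair h3 h4.1 hxd
      (D.apply_add_ne d.2.2) hpair
    obtain ⟨y, hy, h6, h7⟩ := exists_common_shift hF hw hw' hww (d.1 - d'.1)
    have hle : U ⊓ s.orthogonal A ≤ B ⊓ s.orthogonal A := inf_le_inf_right _ h5.1
    let z : D.Point := d + ⟨y, hle hy⟩
    have hz : D.x₀ + z.1 ∈ U := by
      have : D.x₀ + z.1 = D.x₀ + d.1 + y := (add_assoc _ _ _).symm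
      rw [this]
      exact add_mem hxd hy.1
    have e1 : z.1 - d.1 = y := add_sub_cancel_left _ _
    have e2 : z.1 - d'.1 = d.1 - d'.1 + y := (sub_add_eq_add_sub _ _ _).symm
    rw [← e1] at h6
    rw [← e2] at h7
    have hadj : ∀ d : D.Point, (∃ x ∈ U ⊓ s.orthogonal A, s (z.1 - d.1) x ≠ 0) → D.Adj d z :=
      fun d ⟨x, hx, hx'⟩ => ⟨x, hle hx, hx'⟩
    exact (Relation.EqvGen.rel d z (Or.inl ⟨hadj d h6,
      Or.inr (D.radFree_join_of h4 d z hxd hz h6)⟩)).trans _ _ _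
      ((Relation.EqvGen.rel d' z (Or.inl ⟨hadj d' h7,
        Or.inr (D.radFree_join_of h4 d' z hxd' hz h7)⟩)).symm _ _)
  · by_cases huA : d'.1 - d.1 ∈ A
    · have hpt : D.pt d = D.pt d' := by
        refine eq_of_le_of_finrank_le (sup_singleton_le le_sup_left ?_)
          (by rw [D.finrank_pt, D.finrank_pt])
        have h6 : D.x₀ + d.1 = (D.x₀ + d'.1) - (d'.1 - d.1) := by abel
        rw [h6]
        exact sub_mem (self_mem_sup_singleton _ _) (mem_sup_left huA)
      obtain ⟨z, hz, hz'⟩ := D.exists_adj hF hd d d'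
      refine Relation.EqvGen.rel _ _ (Or.inr ⟨hpt, hdU, z, hz, hz', ?_⟩)
      change D.pt d ⊔ _ = D.pt d' ⊔ _
      rw [hpt]
    · have hadj : D.Adj d d' := by
        unfold Adj
        by_contra! h
        obtain ⟨a, ha, ρ, hρ, he⟩ := D.exists_eq_add_of_orthogonal (sub_mem d'.2 d.2) h
        have hρU : ρ ∈ U := by
          have : ρ = d'.1 - d.1 - a := by rw [he]; abel
          rw [this]
          exact sub_mem hu (h4.1 ha)
        rw [disjoint_def.1 h5.2 ρ hρU hρ, add_zero] at he
        exact huA (he ▸ ha)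
      refine Relation.EqvGen.rel _ _ (Or.inl ⟨hadj, Or.inl ?_⟩)
      have hdim : finrank F ↥(A ⊔ F ∙ (D.x₀ + d.1)) = finrank F A + 1 := D.finrank_pt d
      refine sup_singleton_eq hdU.le hxd' (fun hmem => huA ?_) (by omega)
      obtain ⟨a, ha, t, hat⟩ := mem_sup_singleton.1 hmem
      have h6 : s D.r (a + t • (D.x₀ + d.1)) = s D.r (D.x₀ + d'.1) := by rw [hat]
      rw [map_add, map_smul, IsAlt_swap D.isAlt (D.r_mem.2 a ha), zero_add, D.apply_add d.2.2,
        D.apply_add d'.2.2, smul_eq_mul] at h6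
      have ht : t = 1 := mul_right_cancel₀ D.ne_zero (by rw [h6, one_mul])
      subst ht
      have h7 : d'.1 - d.1 = a := by
        have : d'.1 - d.1 = (D.x₀ + d'.1) - (D.x₀ + d.1) := by abel
        rw [this, ← hat, one_smul, add_sub_cancel_right]
      rwa [h7]

/-- The span of the three points is nondegenerate. For a radical vector with point coefficients `α,
β, γ`, pairing with `r` gives `α + β + γ = 0`, and pairing with the two differences gives `γ = 0`
and `β = 0`. What remains lies in `A`, inside a nondegenerate point. -/
theorem graph_bounded (hF : ∀ a b : F, ∃ t, t ≠ a ∧ t ≠ b) (hd : finrank F A + 3 ≤ finrank F B)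
    (hd' : finrank F A + 4 ≤ finrank F B) {d₁ d₂ d₃ : D.Point}
    (h : s (d₂.1 - d₁.1) (d₃.1 - d₁.1) ≠ 0) : (D.graph hF hd).Bounded d₁ d₂ d₃ := by
  set M := D.join d₁ d₂ ⊔ F ∙ (D.x₀ + d₃.1) with hMdef
  have hA : A ≤ M := le_sup_left.trans (le_sup_left.trans le_sup_left)
  have h1 : D.x₀ + d₁.1 ∈ M := mem_sup_left (mem_sup_left (self_mem_sup_singleton _ _))
  have h2 : D.x₀ + d₂.1 ∈ M := mem_sup_left (self_mem_sup_singleton _ _)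
  have h3 : D.x₀ + d₃.1 ∈ M := self_mem_sup_singleton _ _
  have hpt : D.pt d₁ ≤ M := sup_singleton_le hA h1
  have hMB : M ≤ B := sup_singleton_le (sup_singleton_le (sup_singleton_le D.radFree.1
    (D.add_mem_right _)) (D.add_mem_right _)) (D.add_mem_right _)
  have hdim : finrank F M ≤ finrank F A + 3 := finrank_sup_triple_le _ _ _ _
  have hq : d₂.1 - d₁.1 ∈ B ⊓ s.orthogonal A := sub_mem d₂.2 d₁.2
  have ht : d₃.1 - d₁.1 ∈ B ⊓ s.orthogonal A := sub_mem d₃.2 d₁.2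
  have hqM : d₂.1 - d₁.1 ∈ M := by simpa using sub_mem h2 h1
  have htM : d₃.1 - d₁.1 ∈ M := by simpa using sub_mem h3 h1
  have hrad : RadFree s M M := by
    refine radFree_iff.2 ⟨le_rfl, fun v hv hvM => ?_⟩
    obtain ⟨v', hv', γ, rfl⟩ := mem_sup_singleton.1 hv
    obtain ⟨v'', hv'', β, rfl⟩ := mem_sup_singleton.1 hv'
    obtain ⟨a, ha, α, rfl⟩ := mem_sup_singleton.1 hv''
    have e1 : ∀ d : D.Point, s (d₂.1 - d₁.1) (D.x₀ + d.1) =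
        s (d₂.1 - d₁.1) (D.x₀ + d₁.1) + s (d₂.1 - d₁.1) (d.1 - d₁.1) := by
      intro d
      rw [← map_add]
      congr 1
      abel
    have e2 : ∀ d : D.Point, s (d₃.1 - d₁.1) (D.x₀ + d.1) =
        s (d₃.1 - d₁.1) (D.x₀ + d₁.1) + s (d₃.1 - d₁.1) (d.1 - d₁.1) := by
      intro d
      rw [← map_add]
      congr 1
      abel
    have h5 := hvM _ hqM
    have h6 := hvM _ htM
    have h4' : s D.r (D.x₀ + d₁.1) * (α + β + γ) = 0 := by
      have e := hvM _ (hA D.r_mem.1)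
      rw [map_add, map_add, map_add, map_smul, map_smul, map_smul,
        IsAlt_swap D.isAlt (D.r_mem.2 a ha), D.apply_add d₁.2.2, D.apply_add d₂.2.2,
        D.apply_add d₃.2.2] at e
      rw [D.apply_add d₁.2.2]
      simp only [smul_eq_mul] at e
      linear_combination e
    have hsum : α + β + γ = 0 := (mul_eq_zero.1 h4').resolve_left (D.apply_add_ne d₁.2.2)
    have h5' : γ = 0 := by
      rw [map_add, map_add, map_add, map_smul, map_smul, map_smul,
        IsAlt_swap D.isAlt (hq.2 a ha), e1 d₂, e1 d₃, D.isAlt.self_eq_zero] at h5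
      simp only [smul_eq_mul] at h5
      have : γ * s (d₂.1 - d₁.1) (d₃.1 - d₁.1) = 0 := by
        linear_combination h5 - s (d₂.1 - d₁.1) (D.x₀ + d₁.1) * hsum
      exact (mul_eq_zero.1 this).resolve_right h
    have h6' : β = 0 := by
      rw [map_add, map_add, map_add, map_smul, map_smul, map_smul,
        IsAlt_swap D.isAlt (ht.2 a ha), e2 d₂, e2 d₃, D.isAlt.self_eq_zero] at h6
      simp only [smul_eq_mul] at h6
      have : β * s (d₃.1 - d₁.1) (d₂.1 - d₁.1) = 0 := by
        linear_combination h6 - s (d₃.1 - d₁.1) (D.x₀ + d₁.1) * hsum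
      exact (mul_eq_zero.1 this).resolve_right fun h0 => h (IsAlt_swap D.isAlt h0)
    have hα : α = 0 := by rw [h5', h6', add_zero, add_zero] at hsum; exact hsum
    subst h5' h6' hα
    simp only [zero_smul, add_zero] at hvM ⊢
    exact (RadFree.of_rad_eq_bot (D.rad_pt d₁) hpt).eq_zero (mem_sup_left ha) hvM
  have hjoin : ∀ d d' : D.Point, D.x₀ + d.1 ∈ M → D.x₀ + d'.1 ∈ M → RadFree s (D.join d d') M :=
    fun d d' hd hd' => hrad.mono (sup_singleton_le (sup_singleton_le hA hd) hd')
  refine ⟨M, ⟨finrank_lt_of_mem hA h1 (D.notMem (D.apply_add_ne d₁.2.2)), by omega, ?_,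
    hrad.mono hA, hrad.of_le hMB⟩, Or.inr (hjoin _ _ h1 h2), Or.inr (hjoin _ _ h2 h3),
    Or.inr (hjoin _ _ h1 h3)⟩
  rw [rad_eq_bot_iff.2 hrad, finrank_bot]
  exact zero_le_one

/-- If the differences are perpendicular, cone off with `d₁ + w`, where `w` in `B ∩ A^⊥` is
perpendicular to none of the three sides. -/
theorem graph_triangle (hF : ∀ a b : F, ∃ t, t ≠ a ∧ t ≠ b) (hd : finrank F A + 3 ≤ finrank F B)
    (hd' : finrank F A + 4 ≤ finrank F B) {d₁ d₂ d₃ : D.Point}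
    (h₁₂ : D.Adj d₁ d₂) (h₂₃ : D.Adj d₂ d₃) (h₁₃ : D.Adj d₁ d₃) :
    (D.graph hF hd).Bounded d₁ d₂ d₃ ∨ ∃ w : D.Point, D.Adj d₁ w ∧ D.Adj d₂ w ∧ D.Adj d₃ w ∧
      (D.graph hF hd).Bounded d₁ d₂ w ∧ (D.graph hF hd).Bounded d₂ d₃ w ∧
      (D.graph hF hd).Bounded d₁ d₃ w := by
  by_cases h : s (d₂.1 - d₁.1) (d₃.1 - d₁.1) = 0
  swap
  · exact Or.inl (D.graph_bounded hF hd hd' h)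
  right
  obtain ⟨w, hw, h1, h2, h3⟩ := exists_apply_ne_zero₃ hF h₁₂ h₁₃ h₂₃
  let z : D.Point := d₁ + ⟨w, hw⟩
  have e1 : z.1 - d₁.1 = w := add_sub_cancel_left _ _
  have e2 : z.1 - d₂.1 = w - (d₂.1 - d₁.1) := by
    rw [← e1]
    abel
  have e3 : z.1 - d₃.1 = w - (d₃.1 - d₁.1) := by
    rw [← e1]
    abel
  have hq : d₂.1 - d₁.1 ∈ B ⊓ s.orthogonal A := sub_mem d₂.2 d₁.2
  have ht : d₃.1 - d₁.1 ∈ B ⊓ s.orthogonal A := sub_mem d₃.2 d₁.2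
  have h1' : s w (d₂.1 - d₁.1) ≠ 0 := fun h0 => h1 (IsAlt_swap D.isAlt h0)
  have h2' : s w (d₃.1 - d₁.1) ≠ 0 := fun h0 => h2 (IsAlt_swap D.isAlt h0)
  refine ⟨z, ⟨_, hq, by rwa [e1]⟩, ⟨_, hq, ?_⟩, ⟨_, ht, ?_⟩, D.graph_bounded hF hd hd' ?_,
    D.graph_bounded hF hd hd' ?_, D.graph_bounded hF hd hd' ?_⟩
  · rwa [e2, LinearMap.map_sub₂, D.isAlt.self_eq_zero, sub_zero]
  · rwa [e3, LinearMap.map_sub₂, D.isAlt.self_eq_zero, sub_zero]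
  · rwa [e1]
  · have e4 : s (d₃.1 - d₂.1) (d₂.1 - d₁.1) = 0 := by
      rw [show d₃.1 - d₂.1 = d₃.1 - d₁.1 - (d₂.1 - d₁.1) by abel, LinearMap.map_sub₂,
        IsAlt_swap D.isAlt h, D.isAlt.self_eq_zero, sub_zero]
    rwa [e2, map_sub, e4, sub_zero]
  · rwa [e1]

theorem cocyclesTrivial (D : DegenerateData s A B) {H : Type*} [Group H] (hF : ∀ a b : F, ∃ t, t ≠ a ∧ t ≠ b)
    (hd : finrank F A + 4 ≤ finrank F B) : CocyclesTrivial H (Interval s A B) (RadLe s) := by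
  have hd3 : finrank F A + 3 ≤ finrank F B := by omega
  have : Nonempty D.Point := ⟨0⟩
  refine (D.graph hF hd3).cocyclesTrivial (fun _ _ _ _ _ _ => RadLe.trans) ?_ ?_
    (fun i j k hij hjk hik => D.graph_triangle hF hd3 hd hij hjk hik)
    (fun U hU i j => D.graph_link hF hd3 hU i j)
  · rintro o i j ⟨w, hw, hww⟩
    have hv : j.1 - i.1 ∈ B ⊓ s.orthogonal A := sub_mem j.2 i.2
    have hwv : s w (j.1 - i.1) ≠ 0 := fun h0 => hww (IsAlt_swap D.isAlt h0)
    -- The point `i + α w` is tested against `j - i` for adjacency to `o` and `i`, which excludes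
    -- two values of `α`; adjacency to `j` is tested against `w` and is automatic.
    obtain ⟨α, hα0, hα⟩ := hF 0 (-(s (i.1 - o.1) (j.1 - i.1)) / s w (j.1 - i.1))
    let z : D.Point := i + ⟨α • w, smul_mem _ _ hw⟩
    have e1 : z.1 - i.1 = α • w := add_sub_cancel_left _ _
    have e2 : z.1 - o.1 = (i.1 - o.1) + α • w := by
      rw [← e1]
      abel
    have e3 : z.1 - j.1 = α • w - (j.1 - i.1) := by
      rw [← e1]
      abel
    refine ⟨z, ⟨_, hv, fun h0 => hα ?_⟩, ⟨_, hv, ?_⟩, ⟨w, hw, ?_⟩⟩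
    · rw [e2, map_add, LinearMap.add_apply, map_smul, LinearMap.smul_apply, smul_eq_mul] at h0
      rw [eq_div_iff hwv]
      linear_combination h0
    · rw [e1, map_smul, LinearMap.smul_apply]
      exact smul_ne_zero hα0 hwv
    · rwa [e3, LinearMap.map_sub₂, map_smul, LinearMap.smul_apply, D.isAlt.self_eq_zero,
        smul_zero, zero_sub, neg_ne_zero]
  · intro o i z z' _ _ _ _
    by_cases hoi : D.Adj o i
    · exact Or.inl hoi
    by_cases hzz : D.Adj z z'
    · exact Or.inr (Or.inl hzz)
    obtain ⟨w, hw1, hw2⟩ := D.exists_adj hF hd3 o z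
    -- Nonadjacent points differ by a vector of the radical of `B ∩ A^⊥`, so they have the same
    -- neighbours. A common neighbour of `o` and `z` is thus one of all four.
    have key : ∀ i j : D.Point, ¬ D.Adj i j → D.Adj i w → D.Adj j w := by
      rintro i j hij ⟨x, hx, hxw⟩
      refine ⟨x, hx, ?_⟩
      have h0 : s (j.1 - i.1) x = 0 := by
        by_contra h
        exact hij ⟨x, hx, h⟩
      have e : w.1 - j.1 = (w.1 - i.1) - (j.1 - i.1) := by abel
      rwa [e, map_sub, LinearMap.sub_apply, h0, sub_zero]
    exact Or.inr (Or.inr ⟨w, hw1, key o i hoi hw1, hw2, key z z' hzz hw2⟩)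

end DegenerateData

variable [FiniteDimensional F V]

theorem Interval.isConn (hF : ∀ a b : F, ∃ t, t ≠ a ∧ t ≠ b) (hs : s.IsAlt)
    {A B : Submodule F V} (hA : finrank F (rad s A) ≤ 1) (hB : finrank F (rad s B) ≤ 1)
    (hAB : RadFree s A B) (hd : finrank F A + 3 ≤ finrank F B) :
    IsConn (Interval s A B) (RadLe s) := by
  by_cases hb : rad s A = ⊥
  · exact (nondegGraph hs hb hAB.1 hd).isConn
  · obtain ⟨D⟩ := exists_degenerateData hs hA hB hAB hb
    exact (D.graph hF hd).isConn

theorem Interval.cocyclesTrivial {H : Type*} [Group H] (hF : ∀ a b : F, ∃ t, t ≠ a ∧ t ≠ b)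
    (hs : s.IsAlt) {A B : Submodule F V} (hA : finrank F (rad s A) ≤ 1)
    (hB : finrank F (rad s B) ≤ 1) (hAB : RadFree s A B) (hd : finrank F A + 4 ≤ finrank F B) :
    CocyclesTrivial H (Interval s A B) (RadLe s) := by
  by_cases hb : rad s A = ⊥
  · exact nondeg_cocyclesTrivial hF hs hb hAB.1 hB hd
  · obtain ⟨D⟩ := exists_degenerateData hs hA hB hAB hb
    exact D.cocyclesTrivial hF hd

end DegenerateBottom
-- From simply connected residues to amalgams of parabolic subgroups.
namespace PreGeometry

variable {I G : Type*} (Γ : PreGeometry I) [Group G] [MulAction G Γ.Obj]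

/-- The residue of type `J` on the chamber `C`. -/
def residue (C : Set Γ.Obj) (J : Set I) : Set Γ.Obj :=
  {X | Γ.typ X ∈ J ∧ ∀ Y ∈ C, Γ.typ Y ∉ J → Γ.Inc X Y}

variable {Γ} in
theorem IsFlag.eq_of_typ_eq {C : Set Γ.Obj} (hC : Γ.IsFlag C) {X Y : Γ.Obj} (hX : X ∈ C)
    (hY : Y ∈ C) (h : Γ.typ X = Γ.typ Y) : X = Y :=
  (Γ.eq_or_typ_ne X Y (hC X hX Y hY)).resolve_right fun h' => h' h

/-- Setwise and pointwise stabilizers of a subflag agree: the action preserves types, and a flag has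
at most one object of each type. -/
theorem mem_parabolic_iff (hG : ∀ (g : G) (X : Γ.Obj), Γ.typ (g • X) = Γ.typ X) {C : Set Γ.Obj}
    (hC : Γ.IsFlag C) {K : Set I} {g : G} :
    g ∈ Γ.parabolic G C K ↔ ∀ X ∈ C, Γ.typ X ∉ K → g • X = X := by
  constructor
  · intro hg X hX hXK
    have h1 : g • Γ.subflag C K = Γ.subflag C K := hg
    have h2 : g • X ∈ Γ.subflag C K := by
      rw [← h1]
      exact Set.smul_mem_smul_set ⟨hX, hXK⟩
    exact hC.eq_of_typ_eq h2.1 hX (hG g X)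
  · intro h
    change g • Γ.subflag C K = Γ.subflag C K
    ext X
    constructor
    · rintro ⟨Y, hY, rfl⟩
      change g • Y ∈ _
      rw [h Y hY.1 hY.2]
      exact hY
    · intro hX
      exact ⟨X, hX, h X hX.1 hX.2⟩

/-- If the parabolic subgroup `P_J` is transitive on the flags of size at most three of the residue
of type `J`, which is connected and has only trivial cocycles, then `P_J` is the universal
completion of the amalgam of the smaller parabolic subgroups. -/
theorem isUniversalCompletion_parabolicAmalgam
    (hG : ∀ (g : G) (X : Γ.Obj), Γ.typ (g • X) = Γ.typ X) {C : Set Γ.Obj} (hC : Γ.IsChamber C)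
    {J : Set I} (hJ : J.Nonempty)
    (hinc : ∀ (g : G) (X Y : Γ.Obj), Γ.Inc X Y → Γ.Inc (g • X) (g • Y))
    (htrans : ∀ X ∈ Γ.residue C J, ∀ Y ∈ Γ.residue C J, ∀ Z ∈ Γ.residue C J,
      Γ.Inc X Y → Γ.Inc Y Z → Γ.Inc X Z → ∃ g ∈ Γ.parabolic G C J, ∀ B ∈ C, ∀ W,
        W = X ∨ W = Y ∨ W = Z → Γ.typ B = Γ.typ W → g • B = W)
    (hconn : IsConn (Γ.residue C J) Γ.Inc)
    (hcoc : ∀ c : Γ.Obj → Γ.Obj → (Γ.parabolicAmalgam G hG C J).UniversalCompletion,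
      (∀ X ∈ Γ.residue C J, ∀ Y ∈ Γ.residue C J, ∀ Z ∈ Γ.residue C J,
        Γ.Inc X Y → Γ.Inc Y Z → Γ.Inc X Z → c X Y * c Y Z = c X Z) →
      ∃ p : Γ.Obj → (Γ.parabolicAmalgam G hG C J).UniversalCompletion,
        ∀ X ∈ Γ.residue C J, ∀ Y ∈ Γ.residue C J, Γ.Inc X Y → c X Y = (p X)⁻¹ * p Y) :
    (Γ.parabolicAmalgam G hG C J).IsUniversalCompletion (G := Γ.parabolic G C J)
      (fun K => Subgroup.inclusion (Γ.parabolic_mono hG (le_of_lt K.2))) := by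
  classical
  set 𝒜 := Γ.parabolicAmalgam G hG C J
  have hmem : ∀ {K : Set I} {g : G},
      g ∈ Γ.parabolic G C K ↔ ∀ X ∈ C, Γ.typ X ∉ K → g • X = X := Γ.mem_parabolic_iff hG hC.1
  let ν : ∀ (K : Set I) (_ : K < J) (g : G), g ∈ Γ.parabolic G C K → 𝒜.UniversalCompletion :=
    fun K hK g hg => PresentedGroup.of ⟨(⟨K, hK⟩ : Set.Iio J), (⟨g, hg⟩ : Γ.parabolic G C K)⟩
  have ν_mul : ∀ (K : Set I) (hK : K < J) (g h : G) (hg : g ∈ Γ.parabolic G C K)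
      (hh : h ∈ Γ.parabolic G C K), ν K hK (g * h) (mul_mem hg hh) = ν K hK g hg * ν K hK h hh := by
    intro K hK g h hg hh
    have := PresentedGroup.one_of_mem (rels := {r | 𝒜.Rel r})
      (Amalgam.Rel.mul (𝒜 := 𝒜) ⟨K, hK⟩ (⟨g, hg⟩ : Γ.parabolic G C K) ⟨h, hh⟩)
    rw [map_mul, map_inv, mul_inv_eq_one, map_mul] at this
    exact this.symm
  have ν_mono : ∀ (K L : Set I) (_ : K ≤ L) (hK : K < J) (hL : L < J) (g : G)
      (hg : g ∈ Γ.parabolic G C K) (hg' : g ∈ Γ.parabolic G C L),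
      ν K hK g hg = ν L hL g hg' := by
    intro K L hKL hK hL g hg hg'
    rcases hKL.eq_or_lt with rfl | hlt
    · rfl
    · have := PresentedGroup.one_of_mem (rels := {r | 𝒜.Rel r})
        (Amalgam.Rel.ident (𝒜 := 𝒜) (β := ⟨K, hK⟩) (γ := ⟨L, hL⟩) hlt
          (⟨g, hg⟩ : Γ.parabolic G C K))
      rw [map_mul, map_inv, mul_inv_eq_one] at this
      exact this
  have hlt : ∀ i ∈ J, J \ {i} < J := fun i hi =>
    lt_of_le_of_ne Set.sdiff_subset fun h => by
      have : i ∈ J \ {i} := by rwa [h]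
      exact this.2 rfl
  choose base hbC hbtyp using fun i : I => (by
    have : i ∈ Γ.typ '' C := by rw [hC.2]; trivial
    exact this : ∃ X, X ∈ C ∧ Γ.typ X = i)
  have hbase : ∀ X ∈ C, base (Γ.typ X) = X := fun X hX =>
    hC.1.eq_of_typ_eq (hbC _) hX (hbtyp _)
  let τ : Γ.Obj → Γ.Obj := fun X => base (Γ.typ X)
  let F : Γ.Obj → Γ.parabolic G C J → 𝒜.UniversalCompletion := fun b g =>
    if h : ∃ _ : Γ.typ b ∈ J, g.1 ∈ Γ.parabolic G C (J \ {Γ.typ b}) then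
      ν (J \ {Γ.typ b}) (hlt _ h.1) g.1 h.2 else 1
  have hstab : ∀ X, ∀ g : Γ.parabolic G C J, g • τ X = τ X →
      g.1 ∈ Γ.parabolic G C (J \ {Γ.typ X}) := by
    intro X g hg
    refine hmem.2 fun Y hY hYJ => ?_
    by_cases h : Γ.typ Y ∈ J
    · have h2 : Γ.typ Y = Γ.typ X := by
        by_contra h3
        exact hYJ ⟨h, h3⟩
      have h3 : τ X = Y := by rw [← hbase Y hY, h2]
      rw [← h3]
      exact hg
    · exact hmem.1 g.2 Y hY h
  have hFν : ∀ X (hX : Γ.typ X ∈ J) (g : Γ.parabolic G C J) (hg : g • τ X = τ X),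
      F (τ X) g = ν (J \ {Γ.typ X}) (hlt _ hX) g.1 (hstab X g hg) := by
    intro X hX g hg
    have e : Γ.typ (τ X) = Γ.typ X := hbtyp _
    have h : ∃ _ : Γ.typ (τ X) ∈ J, g.1 ∈ Γ.parabolic G C (J \ {Γ.typ (τ X)}) := by
      rw [e]
      exact ⟨hX, hstab X g hg⟩
    simp only [F]
    rw [dif_pos h]
    exact ν_mono _ _ (by rw [e]) _ _ _ _ _
  have hres : ∀ X ∈ C, Γ.typ X ∈ J → X ∈ Γ.residue C J := fun X hX hXJ =>
    ⟨hXJ, fun Y hY _ => hC.1 X hX Y hY⟩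
  obtain ⟨j, hj⟩ := hJ
  obtain ⟨Φ, hΦ, hΦ'⟩ := exists_hom_of_cocyclesTrivial (P := Γ.parabolic G C J)
    (Γ.residue C J) Γ.Inc τ F
    (by
      intro g X hX
      refine ⟨?_, fun Y hY hYJ => ?_⟩
      · change Γ.typ (g.1 • X) ∈ J
        rw [hG]
        exact hX.1
      · have h1 := hinc g.1 X Y (hX.2 Y hY hYJ)
        rwa [hmem.1 g.2 Y hY hYJ] at h1)
    (fun X hX => hres _ (hbC _) (by simp only [τ]; rw [hbtyp]; exact hX.1))
    (fun g X => by
      have : Γ.typ (g • X) = Γ.typ X := hG g.1 X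
      simp only [τ, this])
    (fun X => by simp only [τ, hbtyp])
    (fun g X Y h => hinc g.1 X Y h)
    Γ.inc_refl
    (fun X _ Y _ => hC.1 _ (hbC _) _ (hbC _))
    (by
      intro X hX Y hY Z hZ h1 h2 h3
      obtain ⟨g, hg, h⟩ := htrans X hX Y hY Z hZ h1 h2 h3
      exact ⟨⟨g, hg⟩, h _ (hbC _) X (Or.inl rfl) (hbtyp _),
        h _ (hbC _) Y (Or.inr (Or.inl rfl)) (hbtyp _),
        h _ (hbC _) Z (Or.inr (Or.inr rfl)) (hbtyp _)⟩)
    (by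
      intro X hX g h hg hh
      have hgh : (g * h) • τ X = τ X := by rw [mul_smul, hh, hg]
      rw [hFν X hX.1 _ hgh, hFν X hX.1 _ hg, hFν X hX.1 _ hh]
      exact ν_mul _ _ _ _ _ _)
    (by
      intro X hX Y hY g hgX hgY
      rw [hFν X hX.1 g hgX, hFν Y hY.1 g hgY]
      -- The two stabilizers intersect in a smaller parabolic of the amalgam, through which the two
      -- images are identified.
      have hK : J \ {Γ.typ X, Γ.typ Y} < J :=
        lt_of_le_of_lt (Set.sdiff_subset_sdiff_right (by simp)) (hlt _ hX.1)
      have hgK : g.1 ∈ Γ.parabolic G C (J \ {Γ.typ X, Γ.typ Y}) := by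
        refine hmem.2 fun W hW hWK => ?_
        by_cases h1 : Γ.typ W = Γ.typ X
        · exact hmem.1 (hstab X g hgX) W hW fun h => h.2 h1
        · refine hmem.1 (hstab Y g hgY) W hW fun h => hWK ⟨h.1, ?_⟩
          rintro (h2 | h2)
          · exact h1 h2
          · exact h.2 h2
      rw [← ν_mono _ _ (Set.sdiff_subset_sdiff_right (by simp)) hK (hlt _ hX.1) g.1 hgK,
        ← ν_mono _ _ (Set.sdiff_subset_sdiff_right (by simp)) hK (hlt _ hY.1) g.1 hgK])
    hconn hcoc ⟨base j, hres _ (hbC j) (by rw [hbtyp]; exact hj)⟩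
  have hcompat : 𝒜.Compatible (G := Γ.parabolic G C J)
      (fun K => Subgroup.inclusion (Γ.parabolic_mono hG (le_of_lt K.2))) := fun _ _ => rfl
  have hπν : ∀ (K : Set I) (hK : K < J) (g : G) (hg : g ∈ Γ.parabolic G C K),
      𝒜.desc _ hcompat (ν K hK g hg) = ⟨g, Γ.parabolic_mono hG hK.le hg⟩ := fun K hK g hg =>
    PresentedGroup.toGroup.of _
  refine ⟨hcompat, ?_, ?_⟩
  · have hid : Φ.comp (𝒜.desc _ hcompat) = MonoidHom.id _ := by
      refine PresentedGroup.ext ?_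
      rintro ⟨⟨K, hK⟩, ⟨g, hg⟩⟩
      -- A proper subset `K` misses some type `i` of `J`, so `P_K` fixes the chamber object of type
      -- `i` and `Φ` is known on it.
      obtain ⟨i, hiJ, hiK⟩ := Set.exists_of_ssubset hK
      have hgb : g • base i = base i := hmem.1 hg _ (hbC i) (by rw [hbtyp]; exact hiK)
      have hb : base i ∈ Γ.residue C J := hres _ (hbC i) (by rw [hbtyp]; exact hiJ)
      have hτb : τ (base i) = base i := hbase _ (hbC i)
      have hgτ : (⟨g, Γ.parabolic_mono hG hK.le hg⟩ : Γ.parabolic G C J) • τ (base i) =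
          τ (base i) := by
        rw [hτb]
        exact hgb
      change Φ (𝒜.desc _ hcompat (ν K hK g hg)) = ν K hK g hg
      have hKb : K ≤ J \ {Γ.typ (base i)} := fun k hk =>
        ⟨(show K ⊆ J from le_of_lt hK) hk, by
          rw [hbtyp]
          rintro rfl
          exact hiK hk⟩
      exact (congrArg Φ (hπν K hK g hg)).trans ((hΦ _ hb _ hgτ).trans
        ((hFν _ hb.1 _ hgτ).trans (ν_mono K _ hKb hK _ g hg _).symm))
    intro a b hab
    exact ((DFunLike.congr_fun hid a).symm.trans (congrArg Φ hab)).trans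
      (DFunLike.congr_fun hid b)
  · intro g
    refine ⟨Φ g, hΦ' (𝒜.desc _ hcompat) ?_ g⟩
    intro X hX g hg
    rw [hFν X hX.1 g hg]
    exact hπν _ _ _ _

end PreGeometry

/-! ### Residues of chains: splitting into joins and intervals. -/

section Residues

open Submodule Module

variable {F V : Type*} [Field F] [AddCommGroup V] [Module F V]

/-- The subspaces of maximal rank with dimension in `J` which are incident with all members of
the chain `C` whose dimension is not in `J`. -/
def ChainResidue (s : LinearMap.BilinForm F V) (C : ℕ → Submodule F V) (J : Set ℕ) :
    Set (Submodule F V) :=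
  {U | finrank F U ∈ J ∧ finrank F (rad s U) ≤ 1 ∧ ∀ i ≤ finrank F V, i ∉ J →
    (i < finrank F U → RadFree s (C i) U) ∧ (finrank F U < i → RadFree s U (C i))}

variable {s : LinearMap.BilinForm F V} {C : ℕ → Submodule F V} {J : Set ℕ}

theorem IsFullChain.mem_chainResidue (hC : IsFullChain s C) (hJ : J ⊆ Set.Ioo 0 (finrank F V))
    {i : ℕ} (hi : i ∈ J) : C i ∈ ChainResidue s C J := by
  have hin : i ≤ finrank F V := (hJ hi).2.le
  refine ⟨by rwa [hC.finrank_eq i hin], hC.finrank_rad_le i hin, fun k hk _ => ?_⟩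
  rw [hC.finrank_eq i hin]
  exact ⟨fun h => hC.radFree _ _ h hin, fun h => hC.radFree _ _ h hk⟩

theorem IsFullChain.chainResidue_Ioo (hC : IsFullChain s C) {a b : ℕ} (hab : a < b)
    (hb : b ≤ finrank F V) : ChainResidue s C (Set.Ioo a b) = Interval s (C a) (C b) := by
  ext U
  simp only [ChainResidue, Interval, Set.mem_ofPred_eq, hC.finrank_eq a (by omega),
    hC.finrank_eq b hb]
  constructor
  · rintro ⟨⟨h1, h2⟩, h3, h4⟩
    exact ⟨h1, h2, h3, (h4 a (by omega) fun h => lt_irrefl _ h.1).1 h1,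
      (h4 b hb fun h => lt_irrefl _ h.2).2 h2⟩
  · rintro ⟨h1, h2, h3, h4, h5⟩
    refine ⟨⟨h1, h2⟩, h3, fun i hi hiJ => ⟨fun h => ?_, fun h => ?_⟩⟩
    · have hia : i ≤ a := by
        by_contra hia
        exact hiJ ⟨by omega, by omega⟩
      rcases hia.lt_or_eq with h6 | rfl
      · exact (hC.radFree i a h6 (by omega)).trans h4
      · exact h4
    · have hib : b ≤ i := by
        by_contra hib
        exact hiJ ⟨by omega, by omega⟩
      rcases hib.lt_or_eq with h6 | rfl
      · exact h5.trans (hC.radFree b i h6 hi)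
      · exact h5

/-- The fixed member `C k` separates the residue: by transitivity through it, an object on one side
is incident with every chain member on the other. -/
theorem IsFullChain.chainResidue_eq_union (hC : IsFullChain s C) {k : ℕ} (hk : k ∉ J)
    (hkn : k ≤ finrank F V) : ChainResidue s C J =
      ChainResidue s C (J ∩ Set.Iio k) ∪ ChainResidue s C (J ∩ Set.Ioi k) := by
  ext U
  constructor
  · rintro ⟨h1, h2, h3⟩
    have hne : finrank F U ≠ k := fun h => hk (h ▸ h1)
    rcases lt_or_gt_of_ne hne with h | h
    · have hUk : RadFree s U (C k) := (h3 k hkn hk).2 h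
      refine Or.inl ⟨⟨h1, h⟩, h2, fun i hi hiJ => ⟨fun h4 => ?_, fun h4 => ?_⟩⟩
      · exact (h3 i hi fun h5 => hiJ ⟨h5, h4.trans h⟩).1 h4
      · rcases lt_trichotomy i k with h5 | rfl | h5
        · exact (h3 i hi fun h6 => hiJ ⟨h6, h5⟩).2 h4
        · exact hUk
        · exact hUk.trans (hC.radFree k i h5 hi)
    · have hUk : RadFree s (C k) U := (h3 k hkn hk).1 h
      refine Or.inr ⟨⟨h1, h⟩, h2, fun i hi hiJ => ⟨fun h4 => ?_, fun h4 => ?_⟩⟩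
      · rcases lt_trichotomy i k with h5 | rfl | h5
        · exact (hC.radFree i k h5 hkn).trans hUk
        · exact hUk
        · exact (h3 i hi fun h6 => hiJ ⟨h6, h5⟩).1 h4
      · exact (h3 i hi fun h5 => hiJ ⟨h5, lt_trans h h4⟩).2 h4
  · rintro (⟨⟨h1, -⟩, h2, h3⟩ | ⟨⟨h1, -⟩, h2, h3⟩) <;>
      exact ⟨h1, h2, fun i hi hiJ => h3 i hi fun h => hiJ h.1⟩

theorem radLe_of_mem_chainResidue {k : ℕ} (hk : k ∉ J) (hkn : k ≤ finrank F V) {U W : Submodule F V}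
    (hU : U ∈ ChainResidue s C (J ∩ Set.Iio k)) (hW : W ∈ ChainResidue s C (J ∩ Set.Ioi k)) :
    RadLe s U W :=
  Or.inr (((hU.2.2 k hkn fun h => hk h.1).2 hU.1.2).trans
    ((hW.2.2 k hkn fun h => hk h.1).1 hW.1.2))

theorem exists_notMem_between_or_eq_Ioo {n : ℕ} (hJ : J ⊆ Set.Ioo 0 n) (hne : J.Nonempty) :
    (∃ k ∉ J, (J ∩ Set.Iio k).Nonempty ∧ (J ∩ Set.Ioi k).Nonempty) ∨
      ∃ a b, a < b ∧ b ≤ n ∧ J = Set.Ioo a b := by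
  have hbdd : BddAbove J := ⟨n, fun i hi => (hJ hi).2.le⟩
  have hm := Nat.sInf_mem hne
  have hM := Nat.sSup_mem hne hbdd
  by_cases h : ∃ k ∉ J, (J ∩ Set.Iio k).Nonempty ∧ (J ∩ Set.Ioi k).Nonempty
  · exact Or.inl h
  · right
    push Not at h
    have h1 := hJ hm
    have h2 := hJ hM
    have hle : sInf J ≤ sSup J := Nat.sInf_le hM
    -- The subtraction does not truncate, since all members of `J` are positive.
    refine ⟨sInf J - 1, sSup J + 1, by omega, h2.2, Set.ext fun k => ⟨fun hk => ?_, fun hk => ?_⟩⟩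
    · have h3 := Nat.sInf_le hk
      have h4 := le_csSup hbdd hk
      have h5 := h1.1
      exact ⟨by omega, by omega⟩
    · by_contra hkJ
      obtain ⟨h3, h4⟩ := hk
      have h5 : sInf J ≠ k := fun h => hkJ (h ▸ hm)
      have h6 : sSup J ≠ k := fun h => hkJ (h ▸ hM)
      have h7 := h k hkJ ⟨sInf J, hm, by simp only [Set.mem_Iio]; omega⟩
      have h8 : sSup J ∈ J ∩ Set.Ioi k := ⟨hM, by simp only [Set.mem_Ioi]; omega⟩
      rw [h7] at h8
      exact h8

theorem ncard_Ioo (a b : ℕ) : (Set.Ioo a b).ncard = b - a - 1 := by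
  rw [Set.ncard_eq_toFinset_card', Set.toFinset_Ioo, Nat.card_Ioo]

variable [FiniteDimensional F V]

theorem IsFullChain.isConn_chainResidue (hF : ∀ a b : F, ∃ t, t ≠ a ∧ t ≠ b) (hs : s.IsAlt)
    (hC : IsFullChain s C) (hJ : J ⊆ Set.Ioo 0 (finrank F V)) (hJ2 : 2 ≤ J.ncard) :
    IsConn (ChainResidue s C J) (RadLe s) := by
  have hne : J.Nonempty := Set.nonempty_of_ncard_ne_zero (by omega)
  rcases exists_notMem_between_or_eq_Ioo hJ hne with ⟨k, hk, ⟨i, hi⟩, ⟨j, hj⟩⟩ | ⟨a, b, hab, hb, rfl⟩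
  · have hkn : k ≤ finrank F V := (lt_trans hj.2 (hJ hj.1).2).le
    rw [hC.chainResidue_eq_union hk hkn]
    exact IsConn.union (fun U hU W hW => radLe_of_mem_chainResidue hk hkn hU hW)
      ⟨_, hC.mem_chainResidue (Set.inter_subset_left.trans hJ) hi⟩
      ⟨_, hC.mem_chainResidue (Set.inter_subset_left.trans hJ) hj⟩
  · rw [hC.chainResidue_Ioo hab hb]
    rw [ncard_Ioo] at hJ2
    exact Interval.isConn hF hs (hC.finrank_rad_le a (by omega)) (hC.finrank_rad_le b hb)
      (hC.radFree a b hab hb)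
      (by rw [hC.finrank_eq a (by omega), hC.finrank_eq b hb]; omega)

/-- With three types in all, one side of a gap carries at least two types and is connected, as the
join lemma requires. Without a gap, three consecutive types make an interval with dimension
difference at least four. -/
theorem IsFullChain.cocyclesTrivial_chainResidue {H : Type*} [Group H]
    (hF : ∀ a b : F, ∃ t, t ≠ a ∧ t ≠ b) (hs : s.IsAlt)
    (hC : IsFullChain s C) (hJ : J ⊆ Set.Ioo 0 (finrank F V)) (hJ3 : 3 ≤ J.ncard) :
    CocyclesTrivial H (ChainResidue s C J) (RadLe s) := by
  have hne : J.Nonempty := Set.nonempty_of_ncard_ne_zero (by omega)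
  rcases exists_notMem_between_or_eq_Ioo hJ hne with ⟨k, hk, ⟨i, hi⟩, ⟨j, hj⟩⟩ | ⟨a, b, hab, hb, rfl⟩
  · have hkn : k ≤ finrank F V := (lt_trans hj.2 (hJ hj.1).2).le
    have hfin : J.Finite := (Set.finite_Ioo _ _).subset hJ
    have hcard : J.ncard ≤ (J ∩ Set.Iio k).ncard + (J ∩ Set.Ioi k).ncard := by
      refine le_trans (Set.ncard_le_ncard (fun x hx => ?_)
        ((hfin.inter_of_left _).union (hfin.inter_of_left _))) (Set.ncard_union_le _ _)
      rcases lt_trichotomy x k with h | h | h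
      · exact Or.inl ⟨hx, h⟩
      · exact absurd (h ▸ hx) hk
      · exact Or.inr ⟨hx, h⟩
    have h1 : J ∩ Set.Iio k ⊆ Set.Ioo 0 (finrank F V) := Set.inter_subset_left.trans hJ
    have h2 : J ∩ Set.Ioi k ⊆ Set.Ioo 0 (finrank F V) := Set.inter_subset_left.trans hJ
    rw [hC.chainResidue_eq_union hk hkn]
    refine CocyclesTrivial.union (fun U hU W hW => radLe_of_mem_chainResidue hk hkn hU hW) ?_ ?_
      ⟨_, hC.mem_chainResidue h1 hi⟩ ⟨_, hC.mem_chainResidue h2 hj⟩ ?_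
    · intro U hU W hW h
      have h3 := finrank_mono h.le
      have h4 : finrank F U < k := hU.1.2
      have h5 : k < finrank F W := hW.1.2
      omega
    · intro U hU hU'
      exact lt_asymm (show finrank F U < k from hU.1.2) hU'.1.2
    · by_cases h3 : 2 ≤ (J ∩ Set.Iio k).ncard
      · exact Or.inl (hC.isConn_chainResidue hF hs h1 h3)
      · exact Or.inr (hC.isConn_chainResidue hF hs h2 (by omega))
  · rw [hC.chainResidue_Ioo hab hb]
    rw [ncard_Ioo] at hJ3
    exact Interval.cocyclesTrivial hF hs (hC.finrank_rad_le a (by omega)) (hC.finrank_rad_le b hb)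
      (hC.radFree a b hab hb)
      (by rw [hC.finrank_eq a (by omega), hC.finrank_eq b hb]; omega)

end Residues

/-! ### Translation between objects of the geometry and subspaces. -/

section Geometry

open Submodule Module

variable {F V : Type*} [Field F] [AddCommGroup V] [Module F V] [FiniteDimensional F V]
  {s : LinearMap.BilinForm F V}

theorem inc_iff {X Y : Object s} :
    (geometry s).Inc X Y ↔ RadLe s X.carrier Y.carrier ∨ RadLe s Y.carrier X.carrier := by
  constructor
  · rintro (rfl | h | h)
    · exact Or.inl (Or.inl rfl)
    · exact Or.inl (Or.inr h)
    · exact Or.inr (Or.inr h)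
  · rintro ((h | h) | (h | h))
    · exact Or.inl (Object.ext h)
    · exact Or.inr (Or.inl h)
    · exact Or.inl (Object.ext h.symm)
    · exact Or.inr (Or.inr h)

theorem RadFree.of_inc {X Y : Object s} (h : (geometry s).Inc X Y)
    (hlt : finrank F X.carrier < finrank F Y.carrier) : RadFree s X.carrier Y.carrier := by
  rcases inc_iff.1 h with (h | h) | h
  · rw [h] at hlt
    exact absurd hlt (lt_irrefl _)
  · exact h
  · exact absurd (finrank_mono h.le) (by omega)

theorem inc_smul (g : Sp s) (X Y : (geometry s).Obj) (h : (geometry s).Inc X Y) :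
    (geometry s).Inc (g • X) (g • Y) := by
  have key : ∀ X Y : Object s, RadLe s X.carrier Y.carrier →
      RadLe s (g • X).carrier (g • Y).carrier := by
    rintro X Y (h | h)
    · rw [Object.ext h]
      exact Or.inl rfl
    · refine Or.inr ⟨map_mono h.1, ?_⟩
      change Disjoint (X.carrier.map _) (rad s (Y.carrier.map _))
      rw [map_rad]
      exact disjoint_map (g : V ≃ₗ[F] V).injective h.2
  exact inc_iff.2 ((inc_iff.1 h).imp (key X Y) (key Y X))

/-- Adjoining 0 and `V` encodes the conditions on `Rad(V)`: meeting it trivially is incidence with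
the top. -/
theorem isRadChain_of_isFlag (hrad : finrank F (rad s ⊤) ≤ 1) {E : Set (geometry s).Obj}
    (hE : (geometry s).IsFlag E) :
    IsRadChain s (insert ⊥ (insert ⊤ (Object.carrier '' (E : Set (Object s))))) := by
  have hpos : ∀ X : Object s, 0 < finrank F X.carrier := fun X => X.finrank_mem.1
  have hlt : ∀ X : Object s, finrank F X.carrier < finrank F V := fun X => X.finrank_mem.2
  refine ⟨?_, ?_, ?_⟩
  · rintro _ (rfl | rfl | ⟨X, hX, rfl⟩)
    · exact (finrank_mono (rad_le ⊥)).trans (by simp)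
    · exact hrad
    · exact X.finrank_rad_le
  · rintro U hU W hW h
    have h1 : finrank F U < finrank F V := h.trans_le (finrank_le W)
    rcases hU with rfl | rfl | ⟨X, hX, rfl⟩
    · exact ⟨bot_le, disjoint_bot_left⟩
    · rw [finrank_top] at h1
      exact absurd h1 (lt_irrefl _)
    · rcases hW with rfl | rfl | ⟨Y, hY, rfl⟩
      · rw [finrank_bot] at h
        exact absurd h (Nat.not_lt_zero _)
      · exact ⟨le_top, X.disjoint_rad⟩
      · exact RadFree.of_inc (hE X hX Y hY) h
  · rintro _ (rfl | rfl | ⟨X, hX, rfl⟩) _ (rfl | rfl | ⟨Y, hY, rfl⟩) h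
    · rfl
    · rw [finrank_bot, finrank_top] at h
      exact (finrank_eq_zero.1 (by rw [finrank_top, ← h])).symm
    · rw [finrank_bot] at h
      exact absurd (hpos Y) (by omega)
    · rw [finrank_bot, finrank_top] at h
      exact finrank_eq_zero.1 (by rw [finrank_top, h])
    · rfl
    · rw [finrank_top] at h
      exact absurd (hlt Y) (by omega)
    · rw [finrank_bot] at h
      exact absurd (hpos X) (by omega)
    · rw [finrank_top] at h
      exact absurd (hlt X) (by omega)
    · exact congrArg _ (PreGeometry.IsFlag.eq_of_typ_eq hE hX hY (Subtype.ext h))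

/-- Every flag is contained in a full chain. -/
theorem exists_fullChain_of_isFlag (hs : s.IsAlt) (hrad : finrank F (rad s ⊤) ≤ 1)
    {E : Set (geometry s).Obj} (hE : (geometry s).IsFlag E) :
    ∃ C, IsFullChain s C ∧ ∀ X : Object s, X ∈ E → C (finrank F X.carrier) = X.carrier := by
  obtain ⟨C, hC, h⟩ := (isRadChain_of_isFlag hrad hE).exists_fullChain hs (Or.inl rfl)
    (Or.inr (Or.inl rfl))
  exact ⟨C, hC, fun X hX => h _ (Or.inr (Or.inr ⟨X, hX, rfl⟩))⟩

theorem mem_residue_iff {C : Set (geometry s).Obj} (hC : (geometry s).IsChamber C)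
    {c : ℕ → Submodule F V} (hc : IsFullChain s c)
    (hcC : ∀ X : Object s, X ∈ C → c (finrank F X.carrier) = X.carrier)
    {J : Set (TypeSet F V)} {U : Submodule F V} :
    U ∈ ChainResidue s c (Subtype.val '' J) ↔
      ∃ X : Object s, X ∈ (geometry s).residue C J ∧ X.carrier = U := by
  constructor
  · rintro ⟨h1, h2, h3⟩
    obtain ⟨⟨i, hi⟩, hiJ, hiU⟩ := h1
    have hU : finrank F U ∈ Set.Ico 1 (finrank F V) := by
      rw [← hiU]
      exact hi
    have hn : finrank F V ∉ Subtype.val '' J := by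
      rintro ⟨⟨k, hk⟩, -, hk'⟩
      exact absurd hk.2 (not_lt_of_ge hk'.ge)
    have hdis := ((h3 _ le_rfl hn).2 hU.2).2
    rw [hc.top] at hdis
    refine ⟨⟨U, hU, hdis, h2⟩, ⟨?_, ?_⟩, rfl⟩
    · change (⟨finrank F U, hU⟩ : TypeSet F V) ∈ J
      convert hiJ
      exact hiU.symm
    · intro Y hY hYJ
      change Object s at Y
      have hYd : finrank F Y.carrier ∉ Subtype.val '' J := by
        rintro ⟨k, hk, hk'⟩
        exact hYJ (by convert hk; exact Subtype.ext hk'.symm)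
      have h4 := h3 (finrank F Y.carrier) (finrank_le _) hYd
      rw [hcC Y hY] at h4
      rcases lt_trichotomy (finrank F U) (finrank F Y.carrier) with h | h | h
      · exact inc_iff.2 (Or.inl (Or.inr (h4.2 h)))
      · exact absurd ⟨⟨i, hi⟩, hiJ, hiU.trans h⟩ hYd
      · exact inc_iff.2 (Or.inr (Or.inr (h4.1 h)))
  · rintro ⟨X, ⟨h1, h2⟩, rfl⟩
    refine ⟨⟨_, h1, rfl⟩, X.finrank_rad_le, fun i hi hiJ => ?_⟩
    have hX := X.finrank_mem
    rcases Nat.eq_zero_or_pos i with rfl | hpos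
    · rw [hc.zero]
      exact ⟨fun _ => ⟨bot_le, disjoint_bot_left⟩, fun h => absurd h (Nat.not_lt_zero _)⟩
    rcases hi.lt_or_eq with hlt | rfl
    · have hmem : (⟨i, hpos, hlt⟩ : TypeSet F V) ∈ (geometry s).typ '' C := by
        rw [hC.2]
        trivial
      obtain ⟨Y, hY, hYi⟩ := hmem
      change Object s at Y
      have hYi' : finrank F Y.carrier = i := congrArg Subtype.val hYi
      have hinc := h2 Y hY (by
        rw [hYi]
        intro h
        exact hiJ ⟨_, h, rfl⟩)
      rw [← hYi', hcC Y hY]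
      exact ⟨fun h => RadFree.of_inc ((geometry s).inc_symm _ _ hinc) h,
        fun h => RadFree.of_inc hinc h⟩
    · rw [hc.top]
      exact ⟨fun h => absurd hX.2 (not_lt_of_gt h), fun _ => ⟨le_top, X.disjoint_rad⟩⟩

end Geometry
end QuasiPhan

/-! ### The main theorem. -/

theorem mainTheorem7 {F V : Type*} [Field F] [AddCommGroup V] [Module F V]
    [FiniteDimensional F V] (s : LinearMap.BilinForm F V) (hs : s.IsAlt)
    (hrad : Module.finrank F (QuasiPhan.rad s ⊤) ≤ 1)
    (hF : 3 ≤ ENat.card F)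
    (C : Set (QuasiPhan.geometry s).Obj) (hC : (QuasiPhan.geometry s).IsChamber C)
    (J : Set (QuasiPhan.TypeSet F V)) (hJ : 3 ≤ J.ncard) :
    ((QuasiPhan.geometry s).parabolicAmalgam (QuasiPhan.Sp s)
        (QuasiPhan.typ_smul s) C J).IsUniversalCompletion
      (G := (QuasiPhan.geometry s).parabolic (QuasiPhan.Sp s) C J)
      (fun K => Subgroup.inclusion
        ((QuasiPhan.geometry s).parabolic_mono (QuasiPhan.typ_smul s) (le_of_lt K.2))) := by
  open QuasiPhan in
  have hF' := exists_ne_and_ne hF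
  have hJne : J.Nonempty := Set.nonempty_of_ncard_ne_zero (by omega)
  obtain ⟨c, hc, hcC⟩ := exists_fullChain_of_isFlag hs hrad hC.1
  have hJ' : Subtype.val '' J ⊆ Set.Ioo 0 (Module.finrank F V) := by
    rintro _ ⟨i, -, rfl⟩
    exact ⟨i.2.1, i.2.2⟩
  have hcard : (Subtype.val '' J).ncard = J.ncard :=
    Set.ncard_image_of_injective J Subtype.val_injective
  have hres {U : Submodule F V} := mem_residue_iff hC hc hcC (J := J) (U := U)
  have hinj : Function.Injective (Object.carrier (s := s)) := fun X Y h => Object.ext h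
  obtain ⟨o, ho⟩ : ∃ X, X ∈ (geometry s).residue C J := by
    obtain ⟨i, hi⟩ := hJne
    obtain ⟨X, hX, -⟩ := hres.1 (hc.mem_chainResidue hJ' ⟨i, hi, rfl⟩)
    exact ⟨X, hX⟩
  have : Nonempty (Object s) := ⟨o⟩
  -- `κ` carries functions of objects over to subspaces; only its values on subspaces underlying
  -- objects matter.
  obtain ⟨κ, hκ⟩ := hinj.hasLeftInverse
  refine PreGeometry.isUniversalCompletion_parabolicAmalgam _ _ hC hJne inc_smul ?_ ?_ ?_
  · intro X hX Y hY Z hZ hXY hYZ hXZ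
    -- Including the fixed subflag makes the isometry between the two full chains lie in `P_J`.
    have hE : (geometry s).IsFlag ({X, Y, Z} ∪ (geometry s).subflag C J) := by
      have hsymm := (geometry s).inc_symm
      have hrefl := (geometry s).inc_refl
      rintro U ((rfl | rfl | rfl) | hU) W ((rfl | rfl | rfl) | hW)
      all_goals first
        | exact hrefl _
        | assumption
        | exact hsymm _ _ ‹_›
        | exact hX.2 _ hW.1 hW.2
        | exact hY.2 _ hW.1 hW.2
        | exact hZ.2 _ hW.1 hW.2
        | exact hsymm _ _ (hX.2 _ hU.1 hU.2)
        | exact hsymm _ _ (hY.2 _ hU.1 hU.2)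
        | exact hsymm _ _ (hZ.2 _ hU.1 hU.2)
        | exact hC.1 _ hU.1 _ hW.1
    obtain ⟨c', hc', hcE⟩ := exists_fullChain_of_isFlag hs hrad hE
    obtain ⟨g, hg, hgc⟩ := hc.exists_isometry hs hc'
    have key : ∀ B W : Object s, B ∈ C → W ∈ ({X, Y, Z} ∪ (geometry s).subflag C J : Set _) →
        (geometry s).typ B = (geometry s).typ W → (⟨g, hg⟩ : Sp s) • B = W := by
      intro B W hB hW hBW
      have hd : Module.finrank F B.carrier = Module.finrank F W.carrier :=
        congrArg Subtype.val hBW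
      have h1 := hgc _ (Submodule.finrank_le B.carrier)
      rw [hcC B hB, hd, hcE W hW] at h1
      exact Object.ext h1
    refine ⟨⟨g, hg⟩, ?_, fun B hB W hW hBW => key B W hB (Or.inl hW) hBW⟩
    exact ((geometry s).mem_parabolic_iff (typ_smul s) hC.1).2 fun W hW hWJ =>
      key W W hW (Or.inr ⟨hW, hWJ⟩) rfl
  · intro P hP (X : Object s) hX (Y : Object s) hY hPX
    have h := hc.isConn_chainResidue hF' hs hJ' (by omega) (fun U => P (κ U)) (by
      rintro U hU W hW hUW
      obtain ⟨X, hX, rfl⟩ := hres.1 hU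
      obtain ⟨Y, hY, rfl⟩ := hres.1 hW
      rw [hκ, hκ]
      exact hP X hX Y hY (inc_iff.2 (Or.inl hUW))) _ (hres.2 ⟨X, hX, rfl⟩) _ (hres.2 ⟨Y, hY, rfl⟩)
    rw [hκ, hκ] at h
    exact h hPX
  · intro f hf
    obtain ⟨p, hp⟩ := hc.cocyclesTrivial_chainResidue hF' hs hJ' (by omega)
      (fun U W => f (κ U) (κ W)) (by
        rintro U hU W hW T hT hUW hWT
        obtain ⟨X, hX, rfl⟩ := hres.1 hU
        obtain ⟨Y, hY, rfl⟩ := hres.1 hW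
        obtain ⟨Z, hZ, rfl⟩ := hres.1 hT
        rw [hκ, hκ, hκ]
        exact hf X hX Y hY Z hZ (inc_iff.2 (Or.inl hUW)) (inc_iff.2 (Or.inl hWT))
          (inc_iff.2 (Or.inl (hUW.trans hWT))))
    have hp' : ∀ X Y : Object s, X ∈ (geometry s).residue C J → Y ∈ (geometry s).residue C J →
        RadLe s X.carrier Y.carrier → f X Y = (p X.carrier)⁻¹ * p Y.carrier := by
      intro X Y hX hY h
      have := hp _ (hres.2 ⟨X, hX, rfl⟩) _ (hres.2 ⟨Y, hY, rfl⟩) h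
      rwa [hκ, hκ] at this
    refine ⟨fun X => p (Object.carrier X), fun X hX Y hY hXY => ?_⟩
    rcases inc_iff.1 hXY with h | h
    · exact hp' X Y hX hY h
    · have hYX := (geometry s).inc_symm _ _ hXY
      have h1 := hf X hX Y hY X hX hXY hYX ((geometry s).inc_refl X)
      rw [hp' Y X hY hX h, hp' X X hX hX (Or.inl rfl), inv_mul_cancel] at h1
      rw [eq_inv_of_mul_eq_one_left h1, mul_inv_rev, inv_inv]
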